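/- **Model.** Fix $\Delta>0$ and $W>0$. Let $n$ be even and let $m=\lfloor\sqrt n\rfloor$ (so $m=\sqrt n$ if $n$ is a perfect square). On the sphere $S^2$ of unit area, $n$ nodes are split uniformly at random into $n/2$ disjoint source-destination (S-D) pairs. Each node $i$ has a great circle $G_i$, whose pole is uniform on $S^2$, independently over the nodes. On each $G_i$ there are $m$ equidistant lattice points, numbered consecutively by $\mathbb Z/m$, whose placement on the circle is arbitrary (it may depend measurably on the whole configuration of circles, pairs and points $z_{ij}$). Each node performs on its lattice points a natural random walk in slotted time: it starts at a uniform lattice point, and its steps are i.i.d. uniform on $\{-1,0,1\}$; the walks are independent. For $i\ne j$, $z_{ij}=z_{ji}$ is one of the two points of $G_i\cap G_j$, chosen by independent fair coins; $\mathcal C_{ij}$ is the disk of radius $(2+\Delta)\sqrt{\pi/n}$ around $z_{ij}$. Nodes $i\neq j$ are *neighbors* in a time-slot if both are at lattice points of their circles closest to $z_{ij}$. With $d$ the distance on the sphere, a transmission from $i$ to $j$ is *successful* if $d(k,j)\ge(1+\Delta)\,d(i,j)$ for every other simultaneously transmitting node $k$; communication then occurs at rate $W$ per unit of time, and time-slots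 have unit length. For constants $0<a<b$, a configuration is *typical* if for all $i\ne j$ the number of great circles $G_k$ that meet $\mathcal C_{ij}$ lies in $[a\sqrt n,\,b\sqrt n]$. **Scheme $\Pi$** (with parameters $p,\alpha\in(0,1)$). If the configuration is not typical, the sources transmit directly to their destinations, one pair per time-slot, in round-robin order. If it is typical, each time-slot is divided into two sub-slots A and B of equal length, in each of which a packet of $W/2$ bits can be sent. In sub-slot A each source independently becomes active with probability $p$; an active source that has at least one neighbor, with probability $\alpha$, chooses one of its neighbors uniformly at random and transmits to it a new packet intended for its own destination (sources always have packets). If the transmission is successful, the packet is delivered if the receiver is the destination, and otherwise it joins the queue for this S-D pair at the receiver, which acts as a relay. In sub-slot B each node independently becomes active with probability $p$; an active node that has neighbors which are destinations chooses one of these uniformly at random and transmits to it the first packet (in FIFO order) in its queue for it, if there is one; if the transmission is successful, the packet is delivered and leaves the queue, and otherwise it stays there. **Throughput.** Let $B_n(i,t)$ be the number of bits of S-D pair $i$ delivered in the first $t$ time-slots. The scheme *has throughput* $T(n)$ if $$P\Big(\min_{1\le i\le n/2}\ \liminf_{t\to\infty}\tfrac1t B_n(i,t)\ \ge\ T(n)\Big)\to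 1\qquad (n\to\infty,\ n \text{ even}),$$ where $P$ is over the random network and the randomness of the policy. **Theorem.** Scheme $\Pi$ achieves throughput $T(n)=\Theta(1)$. Precisely: for every $\Delta>0$ there are $0<a_0<b_0$ such that for all $0<a\le a_0$, $b\ge b_0$, $W>0$ and $p,\alpha\in(0,1)$ there are constants $c>0$ and $C$ such that, for every placement of the lattice points, scheme $\Pi$ has throughput $T(n)=c$, and every $T(n)$ that is a throughput of scheme $\Pi$ satisfies $T(n)\le C$ for all sufficiently large $n$. -/

import Mathlib

open MeasureTheory ProbabilityTheory Filter Topology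

namespace MobileNet

noncomputable section

/-! ### The sphere of unit area

A point of the sphere of unit area (radius `1 / (2 √π)`) is represented by its direction, a unit
vector of `ℝ³`; distances are measured on the sphere of unit area. -/

/-- Euclidean three-space. -/
abbrev E3 : Type := EuclideanSpace ℝ (Fin 3)

/-- Directions, i.e. points of the sphere. -/
abbrev S2 : Type := Metric.sphere (0 : E3) 1

/-- The uniform probability distribution on the sphere. -/
def sphereUniform : Measure S2 :=
  ((volume : Measure E3).toSphere Set.univ)⁻¹ • (volume : Measure E3).toSphere

instance : IsProbabilityMeasure sphereUniform := by
  constructor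
  rw [sphereUniform, Measure.smul_apply, smul_eq_mul]
  refine ENNReal.inv_mul_cancel ?_ (measure_ne_top _ _)
  rw [Ne, Measure.measure_univ_eq_zero]
  exact Measure.toSphere_ne_zero _

/-- Geodesic distance on the sphere of unit area between the points in directions `u` and `v`. -/
def gdist (u v : E3) : ℝ := InnerProductGeometry.angle u v / (2 * √Real.pi)

/-- The cross product of `ℝ³`. -/
def cross (u v : E3) : E3 := WithLp.toLp 2 (crossProduct u.ofLp v.ofLp)

/-- The great circle with pole `x`. -/
def greatCircle (x : S2) : Set E3 := {u | ‖u‖ = 1 ∧ inner ℝ (x : E3) u = 0}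

/-- One of the two antipodal intersection points of the great circles with poles `x` and `y`
(when `x ≠ ± y`); the other one is its negative. -/
def crossing (x y : S2) : E3 := ‖cross x y‖⁻¹ • cross x y

/-- The disk on the sphere with center `z` and radius `R`. -/
def disk (z : E3) (R : ℝ) : Set E3 := {u | ‖u‖ = 1 ∧ gdist u z ≤ R}

/-! ### The random network with `n = 2 N` nodes and `N` source-destination pairs -/

/-- The nodes. -/
abbrev Node (N : ℕ) : Type := Fin (2 * N)

/-- The number of lattice points on each great circle: `√n`, rounded down if `n` is not a
perfect square. -/
def latticeSize (N : ℕ) : ℕ := Nat.sqrt (2 * N)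

/-- Assignments of the roles: `(i, false)` goes to the source and `(i, true)` to the destination
of pair `i`. -/
abbrev Pairing (N : ℕ) : Type := (Fin N × Bool) ≃ Node N

instance equivMeasurableSpace {α β : Type} : MeasurableSpace (α ≃ β) := ⊤

instance equivDiscrete {α β : Type} : DiscreteMeasurableSpace (α ≃ β) := ⟨fun _ => trivial⟩

/-- A configuration: the poles of the great circles of the nodes, the S-D pairing, and for each pair
of nodes `i < j` a bit (at `i j`) that selects one of the two intersection points of their great
circles. -/
abbrev Config (N : ℕ) : Type := (Node N → S2) × Pairing N × (Node N → Node N → Bool)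

/-- Poles i.i.d. uniform on the sphere, pairing uniformly random, selections by independent
fair coins. -/
def configMeasure (N : ℕ) : Measure (Config N) :=
  (Measure.pi fun _ => sphereUniform).prod
    ((uniformOn Set.univ).prod
      (Measure.pi fun _ => Measure.pi fun _ => uniformOn Set.univ))

namespace Config

variable {N : ℕ}

/-- The pole of the great circle of node `i`. -/
def pole (s : Config N) (i : Node N) : S2 := s.1 i

/-- The source of pair `i`. -/
def src (s : Config N) (i : Fin N) : Node N := s.2.1 (i, false)

/-- The destination of pair `i`. -/
def dst (s : Config N) (i : Fin N) : Node N := s.2.1 (i, true)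

/-- The selected intersection point of the great circles of two nodes with `i < j`. -/
def meetLt (s : Config N) (i j : Node N) : E3 :=
  if s.2.2 i j then crossing (s.pole i) (s.pole j) else -crossing (s.pole i) (s.pole j)

/-- The selected intersection point `z i j` of the great circles of nodes `i ≠ j`; symmetric. -/
def meet (s : Config N) (i j : Node N) : E3 :=
  if i < j then s.meetLt i j else s.meetLt j i

open Classical in
/-- The number of great circles passing through the disk around `z i j` of radius
`(2 + Δ) √(π / n)`. -/
def crossingCount (Δ : ℝ) (s : Config N) (i j : Node N) : ℕ :=
  (Finset.univ.filter fun k : Node N =>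
    (greatCircle (s.pole k) ∩
      disk (s.meet i j) ((2 + Δ) * √(Real.pi / ((2 * N : ℕ) : ℝ)))).Nonempty).card

/-- Typical configurations, with constants `a` and `b` in the `Θ(√n)` bound. -/
def Typical (Δ a b : ℝ) (s : Config N) : Prop :=
  ∀ i j : Node N, i ≠ j →
    a * √((2 * N : ℕ) : ℝ) ≤ (s.crossingCount Δ i j : ℝ) ∧
      (s.crossingCount Δ i j : ℝ) ≤ b * √((2 * N : ℕ) : ℝ)

end Config

/-- An arbitrary placement of the equidistant lattice points on the great circles: the position of
lattice point number `0` of each node, which may depend on the whole configuration. -/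
structure Placement (N : ℕ) where
  /-- Lattice point number `0` of each node. -/
  start : Config N → Node N → S2
  measurable_start : Measurable start
  start_mem : ∀ s i, (start s i : E3) ∈ greatCircle (s.pole i)

/-- Lattice point number `l` of node `i`. -/
def latticePoint {N : ℕ} (P : Placement N) (s : Config N) (i : Node N)
    (l : ZMod (latticeSize N)) : E3 :=
  Real.cos (2 * Real.pi * (l.val : ℝ) / (latticeSize N : ℝ)) • (P.start s i : E3) +
    Real.sin (2 * Real.pi * (l.val : ℝ) / (latticeSize N : ℝ)) •
      cross (s.pole i) (P.start s i)

/-! ### Randomness of the motion and of the policy -/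

/-- The randomness of one node in one time-slot: the step of its random walk (`0, 1, 2` stand for
`-1, 0, +1`), the coin for becoming active in sub-slot A, the coin for transmitting in sub-slot A
if active, a ranking of the nodes for the random choice in sub-slot A, the coin for becoming
active in sub-slot B, and a ranking of the nodes for the random choice in sub-slot B. -/
abbrev Noise (N : ℕ) : Type :=
  Fin 3 × Bool × Bool × Equiv.Perm (Node N) × Bool × Equiv.Perm (Node N)

namespace Noise

variable {N : ℕ}

/-- The displacement of the random walk. -/
def step (x : Noise N) : ZMod (latticeSize N) := ((x.1 : ℕ) : ZMod (latticeSize N)) - 1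

/-- Whether the node becomes active in sub-slot A (used for sources only). -/
def actA (x : Noise N) : Bool := x.2.1

/-- The coin of bias `α` in sub-slot A. -/
def sendA (x : Noise N) : Bool := x.2.2.1

/-- The ranking for the choice of a relay in sub-slot A. -/
def rankA (x : Noise N) : Equiv.Perm (Node N) := x.2.2.2.1

/-- Whether the node becomes active in sub-slot B. -/
def actB (x : Noise N) : Bool := x.2.2.2.2.1

/-- The ranking for the choice of a destination in sub-slot B. -/
def rankB (x : Noise N) : Equiv.Perm (Node N) := x.2.2.2.2.2

end Noise

/-- The law of the randomness of one node in one time-slot; all six components independent. -/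
def noiseMeasure (p α : unitInterval) (N : ℕ) : Measure (Noise N) :=
  (uniformOn Set.univ).prod
    ((bernoulliMeasure true false p).prod
      ((bernoulliMeasure true false α).prod
        ((uniformOn Set.univ).prod
          ((bernoulliMeasure true false p).prod (uniformOn Set.univ)))))

instance (p α : unitInterval) (N : ℕ) : IsProbabilityMeasure (noiseMeasure p α N) := by
  unfold noiseMeasure
  infer_instance

/-- The sample space: the configuration, the initial lattice positions of the nodes, and the
randomness of each node in each time-slot. -/
abbrev Sample (N : ℕ) : Type :=
  Config N × (Node N → ZMod (latticeSize N)) × (ℕ → Node N → Noise N)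

/-- The probability measure of the random network and of the random policy. Initial positions are
uniform; everything is independent. -/
def law (p α : unitInterval) (N : ℕ) : Measure (Sample N) :=
  (configMeasure N).prod
    ((Measure.pi fun _ => uniformOn Set.univ).prod
      (Measure.infinitePi fun _ : ℕ => Measure.pi fun _ => noiseMeasure p α N))

/-- The lattice position of node `i` in time-slot `t`: a natural random walk. -/
def pos {N : ℕ} (ω : Sample N) (t : ℕ) (i : Node N) : ZMod (latticeSize N) :=
  ω.2.1 i + ∑ τ ∈ Finset.range t, (ω.2.2 τ i).step

/-- The point of the sphere at which node `i` is in time-slot `t`. -/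
def location {N : ℕ} (P : Placement N) (ω : Sample N) (t : ℕ) (i : Node N) : E3 :=
  latticePoint P ω.1 i (pos ω t i)

/-- Node `i` is, in time-slot `t`, at a lattice point of its great circle closest to `z`. -/
def AtClosest {N : ℕ} (P : Placement N) (ω : Sample N) (t : ℕ) (i : Node N) (z : E3) : Prop :=
  ∀ l, gdist (location P ω t i) z ≤ gdist (latticePoint P ω.1 i l) z

/-- Nodes `i` and `j` are neighbors in time-slot `t`. -/
def Neighbor {N : ℕ} (P : Placement N) (ω : Sample N) (t : ℕ) (i j : Node N) : Prop :=
  i ≠ j ∧ AtClosest P ω t i (ω.1.meet i j) ∧ AtClosest P ω t j (ω.1.meet i j)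

/-- `j` is the member of `A` that comes first in the ranking `r`; for a uniformly random ranking
it is a uniformly random member of `A`. -/
def Picks {N : ℕ} (r : Equiv.Perm (Node N)) (A : Set (Node N)) (j : Node N) : Prop :=
  j ∈ A ∧ ∀ k ∈ A, r j ≤ r k

/-- The Relaxed Protocol model: if `x` gives the locations of the nodes and `Tx k l` means that `k`
transmits to `l`, then `i` transmits to `j` and this transmission is successful. -/
def Success {N : ℕ} (Δ : ℝ) (x : Node N → E3) (Tx : Node N → Node N → Prop)
    (i j : Node N) : Prop :=
  Tx i j ∧ ∀ k, k ≠ i → (∃ l, Tx k l) → (1 + Δ) * gdist (x i) (x j) ≤ gdist (x k) (x j)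

/-! ### Policy `Σ_n` -/

section Policy

variable {N : ℕ}

/-- In sub-slot A of time-slot `t`, node `i` transmits to node `j`. -/
def TxA (P : Placement N) (ω : Sample N) (t : ℕ) (i j : Node N) : Prop :=
  (∃ c : Fin N, ω.1.src c = i) ∧ (ω.2.2 t i).actA = true ∧ (ω.2.2 t i).sendA = true ∧
    Picks (ω.2.2 t i).rankA {k | Neighbor P ω t i k} j

/-- In sub-slot B of time-slot `t`, node `i` transmits to node `j`, a destination, a packet
for `j`; here `q i c` is the number of packets of S-D pair `c` queued at relay `i`. -/
def TxB (P : Placement N) (ω : Sample N) (t : ℕ) (q : Node N → Fin N → ℕ)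
    (i j : Node N) : Prop :=
  (ω.2.2 t i).actB = true ∧
    Picks (ω.2.2 t i).rankB {k | Neighbor P ω t i k ∧ ∃ c : Fin N, ω.1.dst c = k} j ∧
    ∃ c : Fin N, ω.1.dst c = j ∧ 0 < q i c

open Classical in
/-- The queues after sub-slot A of time-slot `t`, when they were `q` before it. Sources always have
packets to send; a packet sent directly to its destination is delivered, not queued. -/
def afterA (Δ : ℝ) (P : Placement N) (ω : Sample N) (t : ℕ) (q : Node N → Fin N → ℕ) :
    Node N → Fin N → ℕ := fun r c =>
  q r c + if Success Δ (location P ω t) (TxA P ω t) (ω.1.src c) r ∧ r ≠ ω.1.dst c then 1 else 0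

open Classical in
/-- The queues after sub-slot B of time-slot `t`, when they were `q` before it. Since each relay
keeps a separate queue for each S-D pair, the queue lengths do not depend on the (FIFO) order
of service. -/
def afterB (Δ : ℝ) (P : Placement N) (ω : Sample N) (t : ℕ) (q : Node N → Fin N → ℕ) :
    Node N → Fin N → ℕ := fun r c =>
  q r c - if Success Δ (location P ω t) (TxB P ω t q) r (ω.1.dst c) then 1 else 0

/-- The relay queues at the beginning of time-slot `t`. -/
def queue (Δ : ℝ) (P : Placement N) (ω : Sample N) : ℕ → Node N → Fin N → ℕ
  | 0 => fun _ _ => 0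
  | t + 1 => afterB Δ P ω t (afterA Δ P ω t (queue Δ P ω t))

open Classical in
/-- The number of packets of S-D pair `c` that reach the destination in time-slot `t`: one if the
source transmits successfully to the destination in sub-slot A, and one for each relay that
transmits successfully to the destination in sub-slot B. -/
def delivered (Δ : ℝ) (P : Placement N) (ω : Sample N) (t : ℕ) (c : Fin N) : ℕ :=
  (if Success Δ (location P ω t) (TxA P ω t) (ω.1.src c) (ω.1.dst c) then 1 else 0) +
    (Finset.univ.filter fun r : Node N =>
      Success Δ (location P ω t) (TxB P ω t (afterA Δ P ω t (queue Δ P ω t)))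
        r (ω.1.dst c)).card

/-- Bits of S-D pair `c` transferred in `t` time-slots under policy `Σ_n`; a sub-slot has
length `1 / 2`, so a packet has `W / 2` bits. -/
def bitsSigma (Δ W : ℝ) (P : Placement N) (ω : Sample N) (c : Fin N) (t : ℕ) : ℝ :=
  W / 2 * ((∑ τ ∈ Finset.range t, delivered Δ P ω τ c : ℕ) : ℝ)

/-- Bits of S-D pair `c` transferred in `t` time-slots under direct transmission with round-robin
time-division multiplexing: in time-slot `τ` only the source of pair `τ mod N` transmits, to
its destination, so that there is no interference. -/
def bitsDirect (W : ℝ) (c : Fin N) (t : ℕ) : ℝ :=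
  W * (((Finset.range t).filter fun τ => τ % N = (c : ℕ)).card : ℝ)

open Classical in
/-- Bits of S-D pair `c` transferred in `t` time-slots under scheme `Π`. -/
def bitsPi (Δ W a b : ℝ) (P : Placement N) (ω : Sample N) (c : Fin N) (t : ℕ) : ℝ :=
  if ω.1.Typical Δ a b then bitsSigma Δ W P ω c t else bitsDirect W c t

end Policy

/-- A scheme under which `B N ω c t` bits of S-D pair `c` are transferred in `t` time-slots, in the
network of `2 N` nodes with law `μ N`, has throughput `T`: with probability tending to one,
the long-term rate of each S-D pair is at least `T N`. -/
def HasThroughput {Ω : ℕ → Type} [∀ N, MeasurableSpace (Ω N)] (μ : ∀ N, Measure (Ω N))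
    (B : ∀ N, Ω N → Fin N → ℕ → ℝ) (T : ℕ → ℝ) : Prop :=
  Tendsto
    (fun N => μ N {ω | ∀ c : Fin N, T N ≤ liminf (fun t : ℕ => B N ω c t / (t : ℝ)) atTop})
    atTop (𝓝 1)

end

end MobileNet

/-! In a typical configuration the disk around each intersection point meets only `O(√n)` great
circles, so in the stationary regime of the joint walk a given pair of nodes is, with probability
at least a constant over `n`, a pair of neighbors whose transmission no other node disturbs. The
ergodic theorem turns this into frequencies along almost every trajectory. Each of the `n - 2`
nodes that can relay for a source-destination pair therefore receives packets and offers services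
at a rate of order `1 / n`, and since a queue forwards at nearly the smaller of these two rates,
the pair obtains a constant rate. The source sends at most one packet per time-slot, whence the
upper bound.

Typicality: given the poles of `i` and `j`, the great circles near their crossing are those whose
poles lie in a band of width `O(1 / √n)` around the polar great circle of the crossing. Up to the
circles of `i` and `j`, the number of these is binomial with mean of order `√n`, and Chernoff
bounds beat the union over the `n²` pairs. -/

namespace MobileNet

noncomputable section

/-! ### Departures of a queue -/

section Queue

variable {q arr dep a s : ℕ → ℕ}

theorem queue_add_sum_dep (h0 : q 0 = 0) (hq : ∀ t, q (t + 1) + dep t = q t + arr t) (t : ℕ) :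
    q t + ∑ τ ∈ Finset.range t, dep τ = ∑ τ ∈ Finset.range t, arr τ := by
  induction t with
  | zero => simp [h0]
  | succ t ih =>
    rw [Finset.sum_range_succ, Finset.sum_range_succ, ← ih]
    linarith [hq t]

-- The witness `u` is the last time at which the queue was empty: all arrivals before `u` have left
-- by then, and since `u` the queue has never wasted the service it is offered.
theorem exists_sum_arr_add_sum_service_le (h0 : q 0 = 0)
    (hq : ∀ t, q (t + 1) + dep t = q t + arr t) (ha : ∀ t, a t ≤ arr t)
    (hs : ∀ t, 0 < q t + arr t → s t ≤ dep t) (t : ℕ) :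
    ∃ u ≤ t, ∑ τ ∈ Finset.range u, a τ + ∑ τ ∈ Finset.range t, s τ ≤
      ∑ τ ∈ Finset.range t, dep τ + ∑ τ ∈ Finset.range u, s τ := by
  induction t with
  | zero => exact ⟨0, le_rfl, by simp⟩
  | succ t ih =>
    by_cases hpos : 0 < q t + arr t
    · obtain ⟨u, hu, h⟩ := ih
      refine ⟨u, by omega, ?_⟩
      rw [Finset.sum_range_succ _ t, Finset.sum_range_succ _ t]
      linarith [hs t hpos]
    · refine ⟨t + 1, le_rfl, ?_⟩
      have hempty : q (t + 1) = 0 := by have := hq t; omega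
      have hbalance := queue_add_sum_dep h0 hq (t + 1)
      have harr : ∑ τ ∈ Finset.range (t + 1), a τ ≤ ∑ τ ∈ Finset.range (t + 1), arr τ :=
        Finset.sum_le_sum fun τ _ => ha τ
      omega

theorem exists_forall_abs_sub_mul_le {f : ℕ → ℝ} {L ε : ℝ}
    (h : Tendsto (fun t : ℕ => f t / t) atTop (𝓝 L)) (hε : 0 < ε) :
    ∃ C : ℝ, ∀ t : ℕ, |f t - L * t| ≤ ε * t + C := by
  have hev : ∀ᶠ t : ℕ in atTop, |f t - L * t| - ε * t ≤ 0 := by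
    filter_upwards [Metric.tendsto_nhds.1 h ε hε, eventually_gt_atTop 0] with t ht htpos
    have htpos : (0 : ℝ) < t := Nat.cast_pos.2 htpos
    rw [Real.dist_eq, div_sub' htpos.ne', abs_div, abs_of_pos htpos, div_lt_iff₀ htpos,
      mul_comm (t : ℝ)] at ht
    linarith
  obtain ⟨C, hC⟩ := (isBoundedUnder_of_eventually_le hev).bddAbove_range
  exact ⟨C, fun t => by linarith [hC (Set.mem_range_self t)]⟩

theorem eventually_mul_le_sum_dep (h0 : q 0 = 0)
    (hq : ∀ t, q (t + 1) + dep t = q t + arr t) (ha : ∀ t, a t ≤ arr t)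
    (hs : ∀ t, 0 < q t + arr t → s t ≤ dep t) {A S κ : ℝ}
    (hA : Tendsto (fun t : ℕ => ((∑ τ ∈ Finset.range t, a τ : ℕ) : ℝ) / t) atTop (𝓝 A))
    (hS : Tendsto (fun t : ℕ => ((∑ τ ∈ Finset.range t, s τ : ℕ) : ℝ) / t) atTop (𝓝 S))
    (hκA : κ < A) (hκS : κ < S) :
    ∀ᶠ t : ℕ in atTop, κ * t ≤ ((∑ τ ∈ Finset.range t, dep τ : ℕ) : ℝ) := by
  obtain ⟨ε, hε, hεA, hεS⟩ : ∃ ε > 0, κ + 4 * ε ≤ A ∧ κ + 4 * ε ≤ S :=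
    ⟨(min A S - κ) / 4, by linarith [lt_min hκA hκS], by linarith [min_le_left A S],
      by linarith [min_le_right A S]⟩
  obtain ⟨C, hC⟩ := exists_forall_abs_sub_mul_le hA hε
  obtain ⟨C', hC'⟩ := exists_forall_abs_sub_mul_le hS hε
  have hlarge : ∀ᶠ t : ℕ in atTop, C + 2 * C' ≤ ε * t :=
    (tendsto_natCast_atTop_atTop.const_mul_atTop hε).eventually_ge_atTop _
  filter_upwards [hlarge] with t ht
  obtain ⟨u, hut, hu⟩ := exists_sum_arr_add_sum_service_le h0 hq ha hs t
  have hut : (u : ℝ) ≤ t := Nat.cast_le.2 hut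
  have hu : ((∑ τ ∈ Finset.range u, a τ : ℕ) : ℝ) + (∑ τ ∈ Finset.range t, s τ : ℕ) ≤
      (∑ τ ∈ Finset.range t, dep τ : ℕ) + (∑ τ ∈ Finset.range u, s τ : ℕ) := by
    exact_mod_cast hu
  have hau := (abs_le.1 (hC u)).1
  have hst := (abs_le.1 (hC' t)).1
  have hsu := (abs_le.1 (hC' u)).2
  have hrate : (κ + 4 * ε) * t ≤ A * u + S * (t - u) := by
    have := mul_le_mul_of_nonneg_right hεA u.cast_nonneg
    have := mul_le_mul_of_nonneg_right hεS (sub_nonneg.2 hut)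
    linarith
  have : ε * u ≤ ε * t := mul_le_mul_of_nonneg_left hut hε.le
  linarith

end Queue

/-! ### The ergodic theorem for random walks on finite groups -/

section SubGaussian

variable {Ω Ω' : Type*} [MeasurableSpace Ω] [MeasurableSpace Ω'] {μ : Measure Ω} {ν : Measure Ω'}

theorem hasSubgaussianMGF_add_prod [SFinite μ] [SFinite ν] {X : Ω → ℝ} {Y : Ω × Ω' → ℝ}
    {c d : NNReal} (hX : HasSubgaussianMGF X c μ) (hYm : Measurable Y)
    (hY : ∀ x, HasSubgaussianMGF (fun y => Y (x, y)) d ν) :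
    HasSubgaussianMGF (fun z => X z.1 + Y z) (c + d) (μ.prod ν) := by
  have hsplit (t : ℝ) (z : Ω × Ω') :
      Real.exp (t * (X z.1 + Y z)) = Real.exp (t * X z.1) * Real.exp (t * Y z) := by
    rw [mul_add, Real.exp_add]
  have hmgf (t : ℝ) (x : Ω) : ∫ y, Real.exp (t * X x) * Real.exp (t * Y (x, y)) ∂ν =
      Real.exp (t * X x) * mgf (fun y => Y (x, y)) ν t := by rw [integral_const_mul, mgf]
  have hintegrable (t : ℝ) :
      Integrable (fun z : Ω × Ω' => Real.exp (t * X z.1) * Real.exp (t * Y z)) (μ.prod ν) := by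
    have hXi := hX.integrable_exp_mul t
    have hae : AEStronglyMeasurable (fun z : Ω × Ω' => Real.exp (t * X z.1) * Real.exp (t * Y z))
        (μ.prod ν) :=
      (hXi.aestronglyMeasurable.comp_fst).mul
        (Real.measurable_exp.comp (hYm.const_mul t)).aestronglyMeasurable
    refine (integrable_prod_iff hae).2 ⟨.of_forall fun x => ?_, ?_⟩
    · exact ((hY x).integrable_exp_mul t).const_mul (Real.exp (t * X x))
    · refine (hXi.mul_const (Real.exp (d * t ^ 2 / 2))).mono' hae.norm.integral_prod_right'
        (.of_forall fun x => ?_)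
      simp only [Real.norm_eq_abs, abs_mul, Real.abs_exp]
      rw [hmgf, abs_of_nonneg (mul_nonneg (Real.exp_nonneg _) mgf_nonneg)]
      exact mul_le_mul_of_nonneg_left ((hY x).mgf_le t) (Real.exp_nonneg _)
  refine ⟨fun t => by simpa only [hsplit] using hintegrable t, fun t => ?_⟩
  calc mgf (fun z => X z.1 + Y z) (μ.prod ν) t
      = ∫ x, Real.exp (t * X x) * mgf (fun y => Y (x, y)) ν t ∂μ := by
        simp only [mgf, hsplit, integral_prod _ (hintegrable t), integral_const_mul]
    _ ≤ ∫ x, Real.exp (t * X x) * Real.exp (d * t ^ 2 / 2) ∂μ :=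
        integral_mono_of_nonneg (.of_forall fun x => mul_nonneg (Real.exp_nonneg _) mgf_nonneg)
          ((hX.integrable_exp_mul t).mul_const _)
          (.of_forall fun x => mul_le_mul_of_nonneg_left ((hY x).mgf_le t) (Real.exp_nonneg _))
    _ = mgf X μ t * Real.exp (d * t ^ 2 / 2) := integral_mul_const _ _
    _ ≤ Real.exp (c * t ^ 2 / 2) * Real.exp (d * t ^ 2 / 2) :=
        mul_le_mul_of_nonneg_right (hX.mgf_le t) (Real.exp_nonneg _)
    _ = Real.exp ((c + d : NNReal) * t ^ 2 / 2) := by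
        rw [← Real.exp_add, NNReal.coe_add]
        ring_nf

theorem ae_eventually_lt_mul_of_hasSubgaussianMGF {S : ℕ → Ω → ℝ} {c : NNReal}
    [IsFiniteMeasure μ] (hc : 0 < c)
    (hS : ∀ n : ℕ, HasSubgaussianMGF (S n) (n * c) μ) {ε : ℝ} (hε : 0 < ε) :
    ∀ᵐ ω ∂μ, ∀ᶠ n : ℕ in atTop, S n ω < ε * n := by
  have hchernoff (n : ℕ) : μ {ω | ε * n ≤ S n ω} ≤
      ENNReal.ofReal (Real.exp (-ε ^ 2 / (2 * c)) ^ n) := by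
    rw [← ofReal_measureReal, ← Real.exp_nat_mul]
    refine ENNReal.ofReal_le_ofReal (((hS n).measure_ge_le (by positivity)).trans_eq ?_)
    rcases n.eq_zero_or_pos with rfl | hn
    · simp
    · have : (0 : ℝ) < n := Nat.cast_pos.2 hn
      have : (0 : ℝ) < c := hc
      push_cast
      congr 1
      field_simp
  have hgeom : Summable fun n : ℕ => Real.exp (-ε ^ 2 / (2 * c)) ^ n :=
    summable_geometric_of_lt_one (Real.exp_nonneg _) <| Real.exp_lt_one_iff.2 <|
      div_neg_of_neg_of_pos (by nlinarith) (by positivity)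
  have hsum : ∑' n : ℕ, μ {ω | ε * n ≤ S n ω} ≠ ⊤ :=
    ne_top_of_le_ne_top hgeom.tsum_ofReal_ne_top (ENNReal.tsum_le_tsum hchernoff)
  filter_upwards [ae_eventually_notMem hsum] with ω hω
  exact hω.mono fun n => not_le.1

theorem ae_tendsto_div_of_hasSubgaussianMGF {S : ℕ → Ω → ℝ} {c : NNReal}
    [IsFiniteMeasure μ] (hc : 0 < c) (hS : ∀ n : ℕ, HasSubgaussianMGF (S n) (n * c) μ) :
    ∀ᵐ ω ∂μ, Tendsto (fun n : ℕ => S n ω / n) atTop (𝓝 0) := by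
  have hpos (k : ℕ) : (0 : ℝ) < 1 / (k + 1) := by positivity
  filter_upwards [ae_all_iff.2 fun k : ℕ =>
      ae_eventually_lt_mul_of_hasSubgaussianMGF hc hS (hpos k),
    ae_all_iff.2 fun k : ℕ =>
      ae_eventually_lt_mul_of_hasSubgaussianMGF hc (fun n => (hS n).neg) (hpos k)]
    with ω hle hge
  rw [Metric.tendsto_nhds]
  intro ε hε
  obtain ⟨k, hk⟩ := exists_nat_one_div_lt hε
  filter_upwards [hle k, hge k, eventually_gt_atTop 0] with n hn hn' hn0
  have hn0 : (0 : ℝ) < n := Nat.cast_pos.2 hn0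
  rw [Pi.neg_apply] at hn'
  rw [Real.dist_eq, sub_zero, abs_div, abs_of_pos hn0]
  refine lt_trans ?_ hk
  rw [div_lt_iff₀ hn0]
  exact abs_lt.2 ⟨by linarith, hn⟩

end SubGaussian

section Poisson

variable {G : Type*} [AddGroup G] [Fintype G] {w : G → ℝ}

-- Since the counting measure is invariant, `∑ x, ∑ s, w s * (g (x + s) - g x) ^ 2` vanishes.
theorem eq_of_harmonic (hw : ∀ s, 0 ≤ w s) (hw1 : ∑ s, w s = 1)
    (hgen : AddSubgroup.closure {s | 0 < w s} = ⊤) {g : G → ℝ}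
    (hg : ∀ x, g x = ∑ s, w s * g (x + s)) (x y : G) : g x = g y := by
  have hinv (s : G) : ∑ x, g (x + s) ^ 2 = ∑ x, g x ^ 2 :=
    Fintype.sum_equiv (Equiv.addRight s) _ _ fun _ => rfl
  have henergy : ∑ s, ∑ x, w s * (g (x + s) - g x) ^ 2 = 0 := by
    have hsquare : ∑ s, ∑ x, w s * g (x + s) ^ 2 = ∑ x, g x ^ 2 := by
      simp only [← Finset.mul_sum, hinv, ← Finset.sum_mul, hw1, one_mul]
    have hcross : ∑ s, ∑ x, 2 * g x * (w s * g (x + s)) = 2 * ∑ x, g x ^ 2 := by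
      rw [Finset.sum_comm, Finset.mul_sum]
      refine Finset.sum_congr rfl fun x _ => ?_
      rw [← Finset.mul_sum, ← hg]
      ring
    have hconst : ∑ s, ∑ x, w s * g x ^ 2 = ∑ x, g x ^ 2 := by
      rw [← Finset.sum_mul_sum, hw1, one_mul]
    calc ∑ s, ∑ x, w s * (g (x + s) - g x) ^ 2
        = ∑ s, ∑ x, w s * g (x + s) ^ 2 - ∑ s, ∑ x, 2 * g x * (w s * g (x + s)) +
            ∑ s, ∑ x, w s * g x ^ 2 := by
          simp only [← Finset.sum_sub_distrib, ← Finset.sum_add_distrib]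
          exact Finset.sum_congr rfl fun s _ => Finset.sum_congr rfl fun x _ => by ring
      _ = 0 := by rw [hsquare, hcross, hconst]; ring
  have hterm (s x : G) : 0 ≤ w s * (g (x + s) - g x) ^ 2 := mul_nonneg (hw s) (sq_nonneg _)
  have hsupp (s : G) (hs : 0 < w s) (x : G) : g (x + s) = g x := by
    rw [Finset.sum_eq_zero_iff_of_nonneg fun s _ => Finset.sum_nonneg fun x _ => hterm s x]
      at henergy
    have hx := (Finset.sum_eq_zero_iff_of_nonneg fun x _ => hterm s x).1
      (henergy s (Finset.mem_univ s)) x (Finset.mem_univ x)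
    exact sub_eq_zero.1 (pow_eq_zero_iff two_ne_zero |>.1
      ((mul_eq_zero.1 hx).resolve_left hs.ne'))
  have hperiod (s : G) : ∀ x, g (x + s) = g x := by
    have hs : s ∈ AddSubgroup.closure {s | 0 < w s} := hgen ▸ AddSubgroup.mem_top s
    induction hs using AddSubgroup.closure_induction with
    | mem s hs => exact hsupp s hs
    | zero => simp
    | add s t _ _ hs ht => exact fun x => by rw [← add_assoc, ht, hs]
    | neg s _ hs => exact fun x => by rw [← hs (x + -s), neg_add_cancel_right]
  simpa using (hperiod (-x + y) x).symm

/-- The operator `1 - P`, where `P` is the transition operator of the random walk on `G` whose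
steps have the probabilities `w`. -/
def walkLaplacian (w : G → ℝ) : (G → ℝ) →ₗ[ℝ] G → ℝ where
  toFun g x := g x - ∑ s, w s * g (x + s)
  map_add' g h := by
    ext x
    simp only [Pi.add_apply, mul_add, Finset.sum_add_distrib]
    ring
  map_smul' r g := by
    ext x
    simp only [Pi.smul_apply, smul_eq_mul, RingHom.id_apply, mul_sub, Finset.mul_sum,
      mul_left_comm]

theorem walkLaplacian_apply (w g : G → ℝ) (x : G) :
    walkLaplacian w g x = g x - ∑ s, w s * g (x + s) := rfl

theorem sum_walkLaplacian (hw1 : ∑ s, w s = 1) (g : G → ℝ) : ∑ x, walkLaplacian w g x = 0 := by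
  have hinv (s : G) : ∑ x, g (x + s) = ∑ x, g x :=
    Fintype.sum_equiv (Equiv.addRight s) _ _ fun _ => rfl
  simp only [walkLaplacian_apply]
  rw [Finset.sum_sub_distrib, Finset.sum_comm]
  simp only [← Finset.mul_sum, hinv, ← Finset.sum_mul, hw1, one_mul, sub_self]

-- On functions on `G`, the Laplacian plus the functional `g ↦ ∑ x, g x` is injective, hence
-- surjective; a preimage of a function of sum zero has itself sum zero.
theorem exists_walkLaplacian_eq (hw : ∀ s, 0 ≤ w s) (hw1 : ∑ s, w s = 1)
    (hgen : AddSubgroup.closure {s | 0 < w s} = ⊤) {F : G → ℝ} (hF : ∑ x, F x = 0) :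
    ∃ g, walkLaplacian w g = F := by
  let T : (G → ℝ) →ₗ[ℝ] G → ℝ :=
    walkLaplacian w + (∑ x, LinearMap.proj x : (G → ℝ) →ₗ[ℝ] ℝ).smulRight 1
  have hT (g : G → ℝ) (x : G) : T g x = walkLaplacian w g x + ∑ y, g y := by simp [T]
  have hsum (g : G → ℝ) (hg : ∑ x, T g x = 0) : ∑ x, g x = 0 := by
    simp only [hT, Finset.sum_add_distrib, sum_walkLaplacian hw1, zero_add, Finset.sum_const,
      Finset.card_univ, nsmul_eq_mul] at hg
    exact (mul_eq_zero.1 hg).resolve_left (Nat.cast_ne_zero.2 Fintype.card_ne_zero)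
  have hinj : Function.Injective T := by
    refine (injective_iff_map_eq_zero T).2 fun g hg => funext fun x => ?_
    have hg0 : ∑ y, g y = 0 := hsum g (by simp [hg])
    have hharm (y : G) : g y = ∑ s, w s * g (y + s) := by
      have hy := congrFun hg y
      rw [hT, hg0, add_zero, walkLaplacian_apply] at hy
      exact sub_eq_zero.1 hy
    have hconst : ∑ y, g y = Fintype.card G * g x := by
      simp [eq_of_harmonic hw hw1 hgen hharm _ x]
    exact (mul_eq_zero.1 (hconst.symm.trans hg0)).resolve_left
      (Nat.cast_ne_zero.2 Fintype.card_ne_zero)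
  obtain ⟨g, hg⟩ := LinearMap.injective_iff_surjective.1 hinj F
  refine ⟨g, funext fun x => ?_⟩
  have hx := hT g x
  rw [hg, hsum g (by rw [hg, hF]), add_zero] at hx
  exact hx.symm

end Poisson

section Walk

variable {G Ξ : Type*} [AddGroup G]

/-- The random walk on `G` started at `x` whose step at time `t` is `step (ω t)`. -/
def walk (step : Ξ → G) (x : G) (ω : ℕ → Ξ) : ℕ → G
  | 0 => x
  | t + 1 => walk step x ω t + step (ω t)

/-- The sequence `ξ, ω 0, ω 1, …`. -/
def cons (ξ : Ξ) (ω : ℕ → Ξ) : ℕ → Ξ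
  | 0 => ξ
  | t + 1 => ω t

/-- The additive functional `∑ t < T, h (Xₜ, ωₜ)` of the random walk `X`. -/
def walkSum (step : Ξ → G) (h : G → Ξ → ℝ) (x : G) (T : ℕ) (ω : ℕ → Ξ) : ℝ :=
  ∑ t ∈ Finset.range T, h (walk step x ω t) (ω t)

theorem walkSum_eq_add_sub (step : Ξ → G) (f : G → Ξ → ℝ) (m : ℝ) (g : G → ℝ) (x : G) (T : ℕ)
    (ω : ℕ → Ξ) : walkSum step f x T ω =
      T * m + walkSum step (fun y ξ => f y ξ - m - (g y - g (y + step ξ))) x T ω +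
        (g x - g (walk step x ω T)) := by
  have htelescope := Finset.sum_range_sub' (fun t => g (walk step x ω t)) T
  simp only [walkSum, Finset.sum_sub_distrib, Finset.sum_const, Finset.card_range, nsmul_eq_mul]
  simp only [walk, Finset.sum_sub_distrib] at htelescope
  linarith

theorem walk_cons_succ (step : Ξ → G) (x : G) (ξ : Ξ) (ω : ℕ → Ξ) (t : ℕ) :
    walk step x (cons ξ ω) (t + 1) = walk step (x + step ξ) ω t := by
  induction t with
  | zero => rfl
  | succ t ih => rw [walk, ih, walk, cons]

theorem walkSum_cons_succ (step : Ξ → G) (h : G → Ξ → ℝ) (x : G) (ξ : Ξ) (ω : ℕ → Ξ) (T : ℕ) :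
    walkSum step h x (T + 1) (cons ξ ω) = h x ξ + walkSum step h (x + step ξ) T ω := by
  rw [walkSum, Finset.sum_range_succ', add_comm]
  simp only [walk_cons_succ]
  rfl

variable [MeasurableSpace Ξ] {ν : Measure Ξ} [IsProbabilityMeasure ν]

theorem measurePreserving_cons :
    MeasurePreserving (fun z : Ξ × (ℕ → Ξ) => cons z.1 z.2)
      (ν.prod (Measure.infinitePi fun _ : ℕ => ν)) (Measure.infinitePi fun _ : ℕ => ν) := by
  have hmeas : Measurable fun z : Ξ × (ℕ → Ξ) => cons z.1 z.2 := by
    refine measurable_pi_iff.2 fun t => ?_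
    cases t with
    | zero => exact measurable_fst
    | succ t => exact (measurable_pi_apply t).comp measurable_snd
  refine ⟨hmeas, Measure.eq_infinitePi _ fun s t ht => ?_⟩
  classical
  have hpre : (fun z : Ξ × (ℕ → Ξ) => cons z.1 z.2) ⁻¹' Set.pi s t =
      (if 0 ∈ s then t 0 else Set.univ) ×ˢ
        Set.pi (s.preimage Nat.succ Nat.succ_injective.injOn) fun i => t (i + 1) := by
    ext z
    simp only [Set.mem_preimage, Set.mem_pi, Set.mem_prod, Finset.mem_coe, Finset.mem_preimage]
    constructor
    · intro h
      refine ⟨?_, fun i hi => h _ hi⟩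
      split_ifs with h0
      exacts [h 0 h0, trivial]
    · rintro ⟨h0, h⟩ (_ | i) hi
      · rwa [if_pos hi] at h0
      · exact h i hi
  rw [Measure.map_apply hmeas (.pi s.countable_toSet fun i _ => ht i), hpre, Measure.prod_prod,
    Measure.infinitePi_pi _ fun i _ => ht _]
  have hfilter : {i ∈ s | i ∉ Set.range Nat.succ} = if 0 ∈ s then {0} else ∅ := by
    ext i
    rcases i with _ | i <;> split_ifs with h0 <;> simp [h0]
  rw [Finset.prod_preimage' Nat.succ s Nat.succ_injective.injOn fun i => ν (t i),
    ← Finset.prod_filter_mul_prod_filter_not s (· ∈ Set.range Nat.succ), hfilter, mul_comm]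
  split_ifs <;> simp

variable [Finite G] [MeasurableSpace G] [MeasurableSingletonClass G] {step : Ξ → G}
  {h : G → Ξ → ℝ}

theorem measurable_walk (hstep : Measurable step) (x : G) (t : ℕ) :
    Measurable fun ω => walk step x ω t := by
  induction t with
  | zero => exact measurable_const
  | succ t ih =>
    exact (measurable_of_finite fun y : G × G => y.1 + y.2).comp
      (ih.prodMk (hstep.comp (measurable_pi_apply t)))

theorem measurable_walkSum (hstep : Measurable step) (hh : ∀ x, Measurable (h x)) (x : G) (T : ℕ) :
    Measurable (walkSum step h x T) :=
  Finset.measurable_sum _ fun t _ =>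
    (measurable_from_prod_countable_right (f := fun z : G × Ξ => h z.1 z.2) hh).comp
      ((measurable_walk hstep x t).prodMk (measurable_pi_apply t))

theorem hasSubgaussianMGF_walkSum (hstep : Measurable step) (hh : ∀ x, Measurable (h x))
    {c : NNReal} (hsub : ∀ x, HasSubgaussianMGF (h x) c ν) (x : G) (T : ℕ) :
    HasSubgaussianMGF (walkSum step h x T) (T * c) (Measure.infinitePi fun _ : ℕ => ν) := by
  induction T generalizing x with
  | zero =>
    rw [Nat.cast_zero, zero_mul]
    exact HasSubgaussianMGF.fun_zero
  | succ T ih =>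
    have hsplit : HasSubgaussianMGF
        (fun z : Ξ × (ℕ → Ξ) => walkSum step h x (T + 1) (cons z.1 z.2)) (c + T * c)
        (ν.prod (Measure.infinitePi fun _ : ℕ => ν)) := by
      simp only [walkSum_cons_succ]
      refine hasSubgaussianMGF_add_prod (hsub x) ?_ fun ξ => ih (x + step ξ)
      exact (measurable_from_prod_countable_right
        (f := fun z : G × (ℕ → Ξ) => walkSum step h (x + z.1) T z.2)
        fun y => measurable_walkSum hstep hh (x + y) T).comp
          ((hstep.comp measurable_fst).prodMk measurable_snd)
    have hmeas := measurable_walkSum hstep hh x (T + 1)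
    have hident : IdentDistrib (fun z : Ξ × (ℕ → Ξ) => walkSum step h x (T + 1) (cons z.1 z.2))
        (walkSum step h x (T + 1)) (ν.prod (Measure.infinitePi fun _ : ℕ => ν))
        (Measure.infinitePi fun _ : ℕ => ν) :=
      ⟨(hmeas.comp (measurePreserving_cons (ν := ν)).measurable).aemeasurable,
        hmeas.aemeasurable, by
        conv_rhs => rw [← measurePreserving_cons.map_eq]
        exact (Measure.map_map hmeas (measurePreserving_cons (ν := ν)).measurable).symm⟩
    rw [Nat.cast_succ, add_one_mul, add_comm _ c]
    exact hsplit.congr_identDistrib hident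

theorem ae_tendsto_walkSum_div (hstep : Measurable step) (hh : ∀ x, Measurable (h x)) {C : ℝ}
    (hbound : ∀ x ξ, |h x ξ| ≤ C) (hmean : ∀ x, ∫ ξ, h x ξ ∂ν = 0) (x : G) :
    ∀ᵐ ω ∂Measure.infinitePi fun _ : ℕ => ν,
      Tendsto (fun T : ℕ => walkSum step h x T ω / T) atTop (𝓝 0) := by
  have hC : max C 1 - -max C 1 ≠ 0 := by linarith [le_max_right C 1]
  refine ae_tendsto_div_of_hasSubgaussianMGF (c := (‖max C 1 - -max C 1‖₊ / 2) ^ 2) ?_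
    (hasSubgaussianMGF_walkSum hstep hh (fun y => ?_) x)
  · exact pow_pos (half_pos (nnnorm_pos.2 hC)) 2
  · exact hasSubgaussianMGF_of_mem_Icc_of_integral_eq_zero (hh y).aemeasurable
      (.of_forall fun ξ => abs_le.1 ((hbound y ξ).trans (le_max_left C 1))) (hmean y)

end Walk

section Ergodic

variable {G Ξ : Type*} [AddGroup G] [Fintype G] [MeasurableSpace G] [MeasurableSingletonClass G]
  [MeasurableSpace Ξ] {ν : Measure Ξ} [IsProbabilityMeasure ν] {step : Ξ → G} {f : G → Ξ → ℝ}

theorem exists_integral_corrector_eq_zero (hstep : Measurable step)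
    (hgen : AddSubgroup.closure {s | 0 < ν.real (step ⁻¹' {s})} = ⊤)
    (hf : ∀ x, Integrable (f x) ν) :
    ∃ g : G → ℝ, ∀ x,
      ∫ ξ, (f x ξ - (∑ y, ∫ ξ, f y ξ ∂ν) / Fintype.card G - (g x - g (x + step ξ))) ∂ν = 0 := by
  have hlaw (F : G → ℝ) : ∫ ξ, F (step ξ) ∂ν = ∑ s, ν.real (step ⁻¹' {s}) * F s := by
    rw [← integral_map hstep.aemeasurable (measurable_of_finite F).aestronglyMeasurable,
      integral_fintype .of_finite]
    simp only [map_measureReal_apply hstep (measurableSet_singleton _), smul_eq_mul]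
  have hw1 : ∑ s, ν.real (step ⁻¹' {s}) = 1 := by simpa using (hlaw 1).symm
  set m := (∑ y, ∫ ξ, f y ξ ∂ν) / Fintype.card G
  have hm : ∑ y, (∫ ξ, f y ξ ∂ν - m) = 0 := by
    rw [Finset.sum_sub_distrib, Finset.sum_const, Finset.card_univ, nsmul_eq_mul,
      mul_div_cancel₀ _ (Nat.cast_ne_zero.2 Fintype.card_ne_zero), sub_self]
  obtain ⟨g, hg⟩ := exists_walkLaplacian_eq (fun s => measureReal_nonneg) hw1 hgen hm
  refine ⟨g, fun x => ?_⟩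
  have hgint : Integrable (fun ξ => g (x + step ξ)) ν :=
    (Integrable.of_finite (μ := ν.map step) (f := fun s => g (x + s))).comp_measurable hstep
  have hgx := congrFun hg x
  rw [walkLaplacian_apply, ← hlaw fun s => g (x + s)] at hgx
  rw [integral_sub (f := fun ξ => f x ξ - m) ((hf x).sub (integrable_const m))
      (g := fun ξ => g x - g (x + step ξ)) ((integrable_const _).sub hgint),
    integral_sub (hf x) (integrable_const m), integral_sub (integrable_const _) hgint]
  simp only [integral_const, probReal_univ, one_smul, hgx, sub_self]

theorem ae_tendsto_walkSum_div_average (hstep : Measurable step)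
    (hgen : AddSubgroup.closure {s | 0 < ν.real (step ⁻¹' {s})} = ⊤)
    (hf : ∀ x, Measurable (f x)) {C : ℝ} (hbound : ∀ x ξ, |f x ξ| ≤ C) (x : G) :
    ∀ᵐ ω ∂Measure.infinitePi fun _ : ℕ => ν,
      Tendsto (fun T : ℕ => walkSum step f x T ω / T) atTop
        (𝓝 ((∑ y, ∫ ξ, f y ξ ∂ν) / Fintype.card G)) := by
  have hintegrable (y : G) : Integrable (f y) ν :=
    .of_bound (hf y).aestronglyMeasurable C (.of_forall (hbound y))
  obtain ⟨g, hg⟩ := exists_integral_corrector_eq_zero hstep hgen hintegrable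
  set m := (∑ y, ∫ ξ, f y ξ ∂ν) / Fintype.card G
  obtain ⟨K, hK⟩ : ∃ K, ∀ y, |g y| ≤ K := by
    obtain ⟨K, hK⟩ := (Set.finite_range fun y => |g y|).bddAbove
    exact ⟨K, fun y => hK ⟨y, rfl⟩⟩
  have hgb (y z : G) : |g y - g z| ≤ K + K := (abs_sub _ _).trans (add_le_add (hK _) (hK _))
  have hcorrected := ae_tendsto_walkSum_div
    (h := fun y ξ => f y ξ - m - (g y - g (y + step ξ))) hstep (fun y => ((hf y).sub_const m).sub
      ((measurable_of_finite fun s => g y - g (y + s)).comp hstep))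
    (C := C + |m| + (K + K)) (fun y ξ => (abs_sub _ _).trans (add_le_add
      ((abs_sub _ _).trans (add_le_add (hbound y ξ) le_rfl)) (hgb y _))) hg x
  filter_upwards [hcorrected] with ω hω
  have hboundary : Tendsto (fun T : ℕ => (g x - g (walk step x ω T)) / T) atTop (𝓝 0) :=
    tendsto_bdd_div_atTop_nhds_zero (.of_forall fun T => (abs_le.1 (hgb _ _)).1)
      (.of_forall fun T => (abs_le.1 (hgb _ _)).2) tendsto_natCast_atTop_atTop
  have hlim := (hω.const_add m).add hboundary
  rw [add_zero, add_zero] at hlim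
  refine hlim.congr' ?_
  filter_upwards [eventually_ne_atTop 0] with T hT
  have hT : (T : ℝ) ≠ 0 := Nat.cast_ne_zero.2 hT
  rw [walkSum_eq_add_sub step f m g]
  field_simp

end Ergodic

/-! ### Packets and rates -/

section Packets

variable {N : ℕ}

theorem Picks.unique {r : Equiv.Perm (Node N)} {A : Set (Node N)} {j k : Node N}
    (hj : Picks r A j) (hk : Picks r A k) : j = k :=
  r.injective (le_antisymm (hj.2 k hk.1) (hk.2 j hj.1))

theorem Config.dst_injective (s : Config N) : Function.Injective s.dst := fun c d h => by
  simpa using s.2.1.injective h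

theorem Config.src_ne_dst (s : Config N) (c d : Fin N) : s.src c ≠ s.dst d := fun h => by
  simpa using s.2.1.injective h

variable (Δ : ℝ) (P : Placement N) (ω : Sample N)

open Classical in
/-- The number (`0` or `1`) of packets of S-D pair `c` that enter the queue at relay `r` in
time-slot `t`. -/
def arrivals (r : Node N) (c : Fin N) (t : ℕ) : ℕ :=
  if Success Δ (location P ω t) (TxA P ω t) (ω.1.src c) r ∧ r ≠ ω.1.dst c then 1 else 0

open Classical in
/-- The number (`0` or `1`) of packets of S-D pair `c` that leave the queue at relay `r` in
time-slot `t`. -/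
def departures (r : Node N) (c : Fin N) (t : ℕ) : ℕ :=
  if Success Δ (location P ω t) (TxB P ω t (afterA Δ P ω t (queue Δ P ω t))) r (ω.1.dst c)
    then 1 else 0

theorem queue_succ_add_departures (r : Node N) (c : Fin N) (t : ℕ) :
    queue Δ P ω (t + 1) r c + departures Δ P ω r c t =
      queue Δ P ω t r c + arrivals Δ P ω r c t := by
  have hle : departures Δ P ω r c t ≤ afterA Δ P ω t (queue Δ P ω t) r c := by
    unfold departures
    split_ifs with hsucc
    · obtain ⟨_, _, d, hd, hpos⟩ := hsucc.1
      rwa [ω.1.dst_injective hd] at hpos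
    · exact Nat.zero_le _
  exact Nat.sub_add_cancel hle

open Classical in
theorem delivered_eq_add_sum_departures (t : ℕ) (c : Fin N) :
    delivered Δ P ω t c =
      (if Success Δ (location P ω t) (TxA P ω t) (ω.1.src c) (ω.1.dst c) then 1 else 0) +
        ∑ r, departures Δ P ω r c t := by
  simp [delivered, departures, Finset.sum_boole]

open Classical in
theorem direct_add_sum_arrivals_le_one (t : ℕ) (c : Fin N) :
    (if Success Δ (location P ω t) (TxA P ω t) (ω.1.src c) (ω.1.dst c) then 1 else 0) +
      ∑ r, arrivals Δ P ω r c t ≤ 1 := by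
  let S (r : Node N) : Prop := Success Δ (location P ω t) (TxA P ω t) (ω.1.src c) r
  have hsum : (if S (ω.1.dst c) then 1 else 0) + ∑ r, arrivals Δ P ω r c t =
      ∑ r, if S r then 1 else 0 := by
    rw [← Finset.add_sum_erase _ (fun r => if S r then 1 else 0) (Finset.mem_univ (ω.1.dst c)),
      ← Finset.add_sum_erase _ _ (Finset.mem_univ (ω.1.dst c))]
    have hdst : arrivals Δ P ω (ω.1.dst c) c t = 0 := if_neg fun h => h.2 rfl
    rw [hdst, zero_add]
    congr 1
    refine Finset.sum_congr rfl fun r hr => ?_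
    simp only [arrivals, S, Finset.ne_of_mem_erase hr, ne_eq, not_false_eq_true, and_true]
  refine hsum.trans_le ?_
  rw [Finset.sum_boole, Nat.cast_id]
  refine Finset.card_le_one.2 fun r hr r' hr' => ?_
  exact Picks.unique (Finset.mem_filter.1 hr).2.1.2.2.2 (Finset.mem_filter.1 hr').2.1.2.2.2

theorem sum_delivered_le (t : ℕ) (c : Fin N) :
    ∑ τ ∈ Finset.range t, delivered Δ P ω τ c ≤ t := by
  classical
  have hdep (r : Node N) : ∑ τ ∈ Finset.range t, departures Δ P ω r c τ ≤
      ∑ τ ∈ Finset.range t, arrivals Δ P ω r c τ :=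
    (queue_add_sum_dep (q := fun t => queue Δ P ω t r c) rfl
      (queue_succ_add_departures Δ P ω r c) t).le.trans' (Nat.le_add_left _ _)
  calc ∑ τ ∈ Finset.range t, delivered Δ P ω τ c
      ≤ ∑ τ ∈ Finset.range t,
          ((if Success Δ (location P ω τ) (TxA P ω τ) (ω.1.src c) (ω.1.dst c) then 1 else 0) +
            ∑ r, arrivals Δ P ω r c τ) := by
        simp only [delivered_eq_add_sum_departures, Finset.sum_add_distrib]
        refine Nat.add_le_add_left ?_ _
        rw [Finset.sum_comm, Finset.sum_comm (s := Finset.range t)]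
        exact Finset.sum_le_sum fun r _ => hdep r
    _ ≤ ∑ τ ∈ Finset.range t, 1 :=
        Finset.sum_le_sum fun τ _ => direct_add_sum_arrivals_le_one Δ P ω τ c
    _ = t := by simp

theorem sum_departures_le_sum_delivered (c : Fin N) (R : Finset (Node N)) (t : ℕ) :
    ∑ r ∈ R, ∑ τ ∈ Finset.range t, departures Δ P ω r c τ ≤
      ∑ τ ∈ Finset.range t, delivered Δ P ω τ c := by
  classical
  rw [Finset.sum_comm]
  refine Finset.sum_le_sum fun τ _ => ?_
  rw [delivered_eq_add_sum_departures]
  exact (Finset.sum_le_univ_sum_of_nonneg fun _ => Nat.zero_le _).trans (Nat.le_add_left _ _)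

variable {W : ℝ}

theorem bitsPi_nonneg (hW : 0 ≤ W) (a b : ℝ) (c : Fin N) (t : ℕ) :
    0 ≤ bitsPi Δ W a b P ω c t := by
  unfold bitsPi bitsSigma bitsDirect
  split_ifs <;> positivity

theorem bitsPi_le_mul (hW : 0 ≤ W) (a b : ℝ) (c : Fin N) (t : ℕ) :
    bitsPi Δ W a b P ω c t ≤ W * t := by
  unfold bitsPi bitsSigma bitsDirect
  split_ifs
  · have hdelivered : ((∑ τ ∈ Finset.range t, delivered Δ P ω τ c : ℕ) : ℝ) ≤ t := by
      exact_mod_cast sum_delivered_le Δ P ω t c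
    gcongr
    linarith
  · have hslots : ((Finset.range t).filter fun τ => τ % N = (c : ℕ)).card ≤ t :=
      (Finset.card_filter_le _ _).trans_eq (Finset.card_range t)
    gcongr

theorem bitsPi_div_mem_Icc (hW : 0 ≤ W) (a b : ℝ) (c : Fin N) (t : ℕ) :
    bitsPi Δ W a b P ω c t / t ∈ Set.Icc 0 W :=
  ⟨div_nonneg (bitsPi_nonneg Δ P ω hW a b c t) t.cast_nonneg,
    div_le_of_le_mul₀ t.cast_nonneg hW (bitsPi_le_mul Δ P ω hW a b c t)⟩

theorem liminf_bitsPi_div_le (hW : 0 ≤ W) (a b : ℝ) (c : Fin N) :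
    liminf (fun t : ℕ => bitsPi Δ W a b P ω c t / t) atTop ≤ W := by
  refine liminf_le_of_le
    (isBoundedUnder_of ⟨0, fun t => (bitsPi_div_mem_Icc Δ P ω hW a b c t).1⟩) fun x hx => ?_
  obtain ⟨t, ht⟩ := hx.exists
  exact ht.trans (bitsPi_div_mem_Icc Δ P ω hW a b c t).2

theorem le_liminf_bitsPi_div (hW : 0 ≤ W) (a b : ℝ) (c : Fin N) {x : ℝ}
    (h : ∀ᶠ t : ℕ in atTop, x ≤ bitsPi Δ W a b P ω c t / t) :
    x ≤ liminf (fun t : ℕ => bitsPi Δ W a b P ω c t / t) atTop :=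
  le_liminf_of_le (isBoundedUnder_of
    ⟨W, fun t => (bitsPi_div_mem_Icc Δ P ω hW a b c t).2⟩).isCoboundedUnder_ge h

theorem eventually_le_of_hasThroughput (hW : 0 ≤ W) (a b : ℝ) (p α : unitInterval)
    (P : ∀ N, Placement N) {T : ℕ → ℝ}
    (hT : HasThroughput (law p α) (fun N => bitsPi Δ W a b (P N)) T) :
    ∀ᶠ N in atTop, T N ≤ W := by
  filter_upwards [hT.eventually (lt_mem_nhds (show (0 : ENNReal) < 1 from one_pos)),
    eventually_ge_atTop 1] with N hN hN1
  obtain ⟨ω, hω⟩ := nonempty_of_measure_ne_zero hN.ne'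
  exact (hω ⟨0, hN1⟩).trans (liminf_bitsPi_div_le Δ (P N) ω hW a b _)

end Packets

/-! ### Long-term frequencies in the network -/

section Frequencies

theorem pow_le_prod_of_card_le {ι : Type*} {s : Finset ι} {f : ι → ℝ} {r : ℝ} {β : ℕ}
    (hr0 : 0 ≤ r) (hr1 : r ≤ 1) (hf : ∀ k ∈ s, r ≤ f k) (hβ : (s.filter (f · ≠ 1)).card ≤ β) :
    r ^ β ≤ ∏ k ∈ s, f k := by
  rw [← Finset.prod_filter_ne_one]
  calc r ^ β ≤ r ^ (s.filter (f · ≠ 1)).card := pow_le_pow_of_le_one hr0 hr1 hβ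
    _ = ∏ _k ∈ s.filter (f · ≠ 1), r := (Finset.prod_const r).symm
    _ ≤ ∏ k ∈ s.filter (f · ≠ 1), f k :=
      Finset.prod_le_prod (fun _ _ => hr0) fun k hk => hf k (Finset.mem_filter.1 hk).1

variable {N : ℕ}

/-- The joint displacement of all nodes in a time-slot. -/
def jointStep (ξ : Node N → Noise N) (i : Node N) : ZMod (latticeSize N) := (ξ i).step

theorem pos_eq_walk (ω : Sample N) (t : ℕ) : pos ω t = walk jointStep ω.2.1 ω.2.2 t := by
  induction t with
  | zero => ext i; simp [pos, walk]
  | succ t ih =>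
    rw [walk, ← ih]
    ext i
    simp only [pos, jointStep, Finset.sum_range_succ, Pi.add_apply, add_assoc]

theorem latticeSize_pos (hN : 0 < N) : 0 < latticeSize N := Nat.sqrt_pos.2 (by omega)

theorem noiseMeasure_real_prod (p α : unitInterval) (s₁ : Set (Fin 3)) (s₂ s₃ : Set Bool)
    (s₄ : Set (Equiv.Perm (Node N))) (s₅ : Set Bool) (s₆ : Set (Equiv.Perm (Node N))) :
    (noiseMeasure p α N).real (s₁ ×ˢ s₂ ×ˢ s₃ ×ˢ s₄ ×ˢ s₅ ×ˢ s₆) =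
      (uniformOn Set.univ).real s₁ * ((bernoulliMeasure true false p).real s₂ *
        ((bernoulliMeasure true false α).real s₃ * ((uniformOn Set.univ).real s₄ *
          ((bernoulliMeasure true false p).real s₅ * (uniformOn Set.univ).real s₆)))) := by
  simp only [noiseMeasure, measureReal_prod_prod]

theorem bernoulliMeasure_real_true (p : unitInterval) :
    (bernoulliMeasure true false p).real {true} = p := by
  rw [bernoulliMeasure_real_apply_of_mem_of_notMem] <;> simp

theorem bernoulliMeasure_real_false (p : unitInterval) :
    (bernoulliMeasure true false p).real {false} = 1 - p := by
  rw [bernoulliMeasure_real_apply_of_notMem_of_mem] <;> simp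

theorem uniformOn_univ_real_singleton_pos {X : Type*} [Finite X] [MeasurableSpace X]
    [MeasurableSingletonClass X] (x : X) : 0 < (uniformOn (Set.univ : Set X)).real {x} := by
  have : Nonempty X := ⟨x⟩
  refine ENNReal.toReal_pos ?_ (measure_ne_top _ _)
  simp [uniformOn_eq_zero_iff]

theorem pi_noiseMeasure_real_jointStep_single_pos (p α : unitInterval) (i : Node N) :
    0 < (Measure.pi fun _ : Node N => noiseMeasure p α N).real
      (jointStep ⁻¹' {Pi.single i 1}) := by
  have hsub : (Set.univ.pi fun k => ({if k = i then 2 else 1} : Set (Fin 3)) ×ˢ Set.univ) ⊆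
      jointStep ⁻¹' {(Pi.single i 1 : Node N → ZMod (latticeSize N))} := by
    intro ξ hξ
    refine funext fun k => ?_
    have hk : (ξ k).1 = if k = i then 2 else 1 := (hξ k trivial).1
    rcases eq_or_ne k i with rfl | hki
    · simp [jointStep, Noise.step, hk]
      norm_num
    · simp [jointStep, Noise.step, hk, hki]
  refine lt_of_lt_of_le ?_ (measureReal_mono hsub)
  rw [measureReal_def, Measure.pi_pi, ENNReal.toReal_prod]
  refine Finset.prod_pos fun k _ => ?_
  rw [← measureReal_def, noiseMeasure, measureReal_prod_prod, probReal_univ, mul_one]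
  exact uniformOn_univ_real_singleton_pos _

theorem closure_jointStep_eq_top (p α : unitInterval) :
    AddSubgroup.closure {s | 0 < (Measure.pi fun _ : Node N => noiseMeasure p α N).real
      (jointStep ⁻¹' {s})} = ⊤ := by
  refine eq_top_iff.2 fun y _ => ?_
  rw [← Finset.univ_sum_single y]
  refine sum_mem fun i _ => ?_
  have hsingle : Pi.single i (y i) =
        ((y i).cast : ℤ) • (Pi.single i 1 : Node N → ZMod (latticeSize N)) := by
    rw [← Pi.single_zsmul, zsmul_one, ZMod.intCast_zmod_cast]
  rw [hsingle]
  refine zsmul_mem (AddSubgroup.subset_closure ?_) _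
  exact pi_noiseMeasure_real_jointStep_single_pos p α i

theorem ae_law_of_forall_ae {p α : unitInterval} [NeZero (latticeSize N)]
    {Q : (Node N → ZMod (latticeSize N)) → (ℕ → Node N → Noise N) → Prop}
    (h : ∀ x, ∀ᵐ ξ ∂(Measure.infinitePi fun _ : ℕ => Measure.pi fun _ => noiseMeasure p α N),
      Q x ξ) : ∀ᵐ ω ∂(law p α N), Q ω.2.1 ω.2.2 := by
  have hmotion := Measure.quasiMeasurePreserving_snd.ae (ae_all_iff.2 h)
    (μa := (Measure.pi fun _ : Node N => uniformOn (Set.univ : Set (ZMod (latticeSize N)))).prod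
      (Measure.infinitePi fun _ : ℕ => Measure.pi fun _ => noiseMeasure p α N))
  filter_upwards [Measure.quasiMeasurePreserving_snd.ae hmotion (μa := law p α N)] with ω hω
  exact hω _

open Classical in
theorem ae_tendsto_frequency (p α : unitInterval) [NeZero (latticeSize N)]
    (U : Finset (Node N → ZMod (latticeSize N))) (V : Set (Node N → Noise N)) :
    ∀ᵐ ω ∂(law p α N), Tendsto (fun t : ℕ =>
      ((∑ τ ∈ Finset.range t, if pos ω τ ∈ U ∧ ω.2.2 τ ∈ V then 1 else 0 : ℕ) : ℝ) / t) atTop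
        (𝓝 (U.card / (latticeSize N : ℝ) ^ (2 * N) *
          (Measure.pi fun _ : Node N => noiseMeasure p α N).real V)) := by
  let f (y : Node N → ZMod (latticeSize N)) (ξ : Node N → Noise N) : ℝ :=
    if y ∈ U ∧ ξ ∈ V then 1 else 0
  have hf (y : Node N → ZMod (latticeSize N)) :
      ∫ ξ, f y ξ ∂(Measure.pi fun _ : Node N => noiseMeasure p α N) =
        if y ∈ U then (Measure.pi fun _ : Node N => noiseMeasure p α N).real V else 0 := by
    by_cases hy : y ∈ U
    · simp only [f, hy, true_and, if_true]
      exact integral_indicator_one (.of_discrete)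
    · simp [f, hy]
  have hlim (x : Node N → ZMod (latticeSize N)) := ae_tendsto_walkSum_div_average (f := f)
    (.of_discrete) (closure_jointStep_eq_top p α) (fun _ => .of_discrete) (C := 1)
    (fun y ξ => by unfold f; split_ifs <;> simp) x
  filter_upwards [ae_law_of_forall_ae hlim] with ω hω
  simp only [hf, Finset.sum_ite_mem, Finset.univ_inter, Finset.sum_const, nsmul_eq_mul,
    mul_div_right_comm] at hω
  convert hω using 2
  · simp [walkSum, pos_eq_walk, f]
  · simp [ZMod.card]

/-- The joint positions at which `i` is at `u`, `j` is at `v`, and every other node `k`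
avoids `K k`. -/
def isolatedPositions [NeZero (latticeSize N)] (i j : Node N) (u v : ZMod (latticeSize N))
    (K : Node N → Finset (ZMod (latticeSize N))) : Finset (Node N → ZMod (latticeSize N)) :=
  Fintype.piFinset fun k => if k = i then {u} else if k = j then {v} else (K k)ᶜ

section IsolatedPositions

variable [NeZero (latticeSize N)] {i j : Node N} {u v : ZMod (latticeSize N)}
  {K : Node N → Finset (ZMod (latticeSize N))}

theorem mem_isolatedPositions (hij : i ≠ j) {x : Node N → ZMod (latticeSize N)} :
    x ∈ isolatedPositions i j u v K ↔
      x i = u ∧ x j = v ∧ ∀ k, k ≠ i → k ≠ j → x k ∉ K k := by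
  simp only [isolatedPositions, Fintype.mem_piFinset]
  constructor
  · intro h
    refine ⟨by simpa using h i, by simpa [hij.symm] using h j, fun k hki hkj => ?_⟩
    simpa [hki, hkj] using h k
  · rintro ⟨hi, hj, hK⟩ k
    split_ifs with hki hkj
    · simpa [hki] using hi
    · simpa [hkj] using hj
    · simpa using hK k hki hkj

theorem card_isolatedPositions (hij : i ≠ j) :
    (isolatedPositions i j u v K).card =
      ∏ k ∈ (Finset.univ.erase j).erase i, (K k)ᶜ.card := by
  rw [isolatedPositions, Fintype.card_piFinset,
    ← Finset.mul_prod_erase _ _ (Finset.mem_univ j),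
    ← Finset.mul_prod_erase _ _ (Finset.mem_erase.2 ⟨hij, Finset.mem_univ i⟩)]
  simp only [hij.symm, if_true, if_false, Finset.card_singleton, one_mul]
  refine Finset.prod_congr rfl fun k hk => ?_
  simp only [Finset.mem_erase] at hk
  simp [hk.1, hk.2.1]

theorem le_card_isolatedPositions (hij : i ≠ j) (u v : ZMod (latticeSize N)) {q β : ℕ}
    (hq : ∀ k, (K k).card ≤ q) (hqm : q ≤ latticeSize N)
    (hβ : (Finset.univ.filter fun k => (K k).Nonempty).card ≤ β) :
    (1 - q / latticeSize N : ℝ) ^ β / (latticeSize N : ℝ) ^ 2 ≤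
      (isolatedPositions i j u v K).card / (latticeSize N : ℝ) ^ (2 * N) := by
  have hm : (0 : ℝ) < latticeSize N := Nat.cast_pos.2 (Nat.pos_of_neZero _)
  have hrest : 2 * N = ((Finset.univ.erase j).erase i).card + 2 := by
    have hj := Finset.card_erase_add_one (Finset.mem_univ j)
    have hi := Finset.card_erase_add_one (Finset.mem_erase.2 ⟨hij, Finset.mem_univ i⟩)
    rw [Finset.card_univ, Fintype.card_fin] at hj
    omega
  have hfactor (k : Node N) :
      ((K k)ᶜ.card : ℝ) / latticeSize N = 1 - (K k).card / latticeSize N := by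
    rw [Finset.card_compl, ZMod.card, Nat.cast_sub ((hq k).trans hqm), sub_div, div_self hm.ne']
  have hprod : (1 - q / latticeSize N : ℝ) ^ β ≤
      ∏ k ∈ (Finset.univ.erase j).erase i, (((K k)ᶜ.card : ℝ) / latticeSize N) := by
    refine pow_le_prod_of_card_le ?_ ?_ (fun k _ => ?_)
      (hβ.trans' (Finset.card_le_card fun k hk => ?_))
    · rw [sub_nonneg, div_le_one hm]
      exact_mod_cast hqm
    · rw [sub_le_self_iff]
      positivity
    · rw [hfactor]
      have := hq k
      gcongr
    · rw [Finset.mem_filter, hfactor] at hk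
      refine Finset.mem_filter.2 ⟨Finset.mem_univ k, Finset.nonempty_iff_ne_empty.2 fun h => ?_⟩
      simp [h] at hk
  have hpow : (latticeSize N : ℝ) ^ (2 * N) =
      latticeSize N ^ ((Finset.univ.erase j).erase i).card * latticeSize N ^ 2 := by
    rw [← pow_add, ← hrest]
  rw [card_isolatedPositions hij, hpow, ← div_div, Nat.cast_prod, ← Finset.prod_const,
    ← Finset.prod_div_distrib]
  gcongr

end IsolatedPositions

theorem pi_real_pair {ι X : Type*} [Fintype ι] [MeasurableSpace X] (μ : Measure X)
    [IsProbabilityMeasure μ] {i j : ι} (hij : i ≠ j) (S T : Set X) :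
    (Measure.pi fun _ : ι => μ).real {ξ | ξ i ∈ S ∧ ξ j ∈ T} = μ.real S * μ.real T := by
  classical
  have hset : {ξ : ι → X | ξ i ∈ S ∧ ξ j ∈ T} =
      Set.univ.pi fun k => if k = i then S else if k = j then T else Set.univ := by
    ext ξ
    simp only [Set.mem_ofPred_eq, Set.mem_univ_pi]
    constructor
    · rintro ⟨hi, hj⟩ k
      split_ifs with hki hkj
      · simpa [hki] using hi
      · simpa [hkj] using hj
      · trivial
    · intro h
      exact ⟨by simpa using h i, by simpa [hij.symm] using h j⟩
  rw [hset, measureReal_def, Measure.pi_pi, ENNReal.toReal_prod, Fintype.prod_eq_mul i j hij]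
  · simp [hij.symm, measureReal_def]
  · rintro k ⟨hki, hkj⟩
    simp [hki, hkj]

/-- The coins for a transmission from `i` to a silent `j` in sub-slot A. -/
def coinsA (i j : Node N) : Set (Node N → Noise N) :=
  {ξ | ((ξ i).actA = true ∧ (ξ i).sendA = true) ∧ (ξ j).actA = false}

/-- The coins for a transmission from `i` to a silent `j` in sub-slot B. -/
def coinsB (i j : Node N) : Set (Node N → Noise N) :=
  {ξ | (ξ i).actB = true ∧ (ξ j).actB = false}

theorem pi_noiseMeasure_real_coinsA (p α : unitInterval) {i j : Node N} (hij : i ≠ j) :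
    (Measure.pi fun _ : Node N => noiseMeasure p α N).real (coinsA i j) =
      p * α * (1 - p) := by
  have hpair := pi_real_pair (noiseMeasure p α N) hij
    (Set.univ ×ˢ {true} ×ˢ {true} ×ˢ Set.univ ×ˢ Set.univ ×ˢ Set.univ)
    (Set.univ ×ˢ {false} ×ˢ Set.univ ×ˢ Set.univ ×ˢ Set.univ ×ˢ Set.univ)
  simp only [noiseMeasure_real_prod, bernoulliMeasure_real_true, bernoulliMeasure_real_false,
    probReal_univ, one_mul, mul_one] at hpair
  rw [← hpair]
  congr 1
  ext ξ
  simp [coinsA, Noise.actA, Noise.sendA]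

theorem pi_noiseMeasure_real_coinsB (p α : unitInterval) {i j : Node N} (hij : i ≠ j) :
    (Measure.pi fun _ : Node N => noiseMeasure p α N).real (coinsB i j) = p * (1 - p) := by
  have hpair := pi_real_pair (noiseMeasure p α N) hij
    (Set.univ ×ˢ Set.univ ×ˢ Set.univ ×ˢ Set.univ ×ˢ {true} ×ˢ Set.univ)
    (Set.univ ×ˢ Set.univ ×ˢ Set.univ ×ˢ Set.univ ×ˢ {false} ×ˢ Set.univ)
  simp only [noiseMeasure_real_prod, bernoulliMeasure_real_true, bernoulliMeasure_real_false,
    probReal_univ, one_mul, mul_one] at hpair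
  rw [← hpair]
  congr 1
  ext ξ
  simp [coinsB, Noise.actB]

end Frequencies

/-! ### Great circles and lattice points -/

section GreatCircles

open InnerProductGeometry
open scoped Matrix

theorem inner_eq_dotProduct (u v : E3) : inner ℝ u v = u.ofLp ⬝ᵥ v.ofLp := by
  rw [EuclideanSpace.inner_eq_star_dotProduct, star_trivial, dotProduct_comm]

theorem inner_left_cross (u v : E3) : inner ℝ u (cross u v) = 0 := by
  rw [inner_eq_dotProduct, cross, dot_self_cross]

theorem inner_right_cross (u v : E3) : inner ℝ v (cross u v) = 0 := by
  rw [inner_eq_dotProduct, cross, dot_cross_self]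

theorem inner_cross_cross (u v w x : E3) :
    inner ℝ (cross u v) (cross w x) =
      inner ℝ u w * inner ℝ v x - inner ℝ u x * inner ℝ v w := by
  simp only [inner_eq_dotProduct, cross, cross_dot_cross]

theorem inner_cross_sq (x y z : E3) : inner ℝ (cross x y) z ^ 2 =
    inner ℝ x x * (inner ℝ y y * inner ℝ z z - inner ℝ y z ^ 2) -
      inner ℝ x y * (inner ℝ x y * inner ℝ z z - inner ℝ y z * inner ℝ x z) +
        inner ℝ x z * (inner ℝ x y * inner ℝ y z - inner ℝ y y * inner ℝ x z) := by
  simp only [inner_eq_dotProduct, cross, Matrix.vec3_dotProduct, cross_apply,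
    Matrix.cons_val]
  ring

theorem inner_self_eq_one {u : E3} (hu : ‖u‖ = 1) : inner ℝ u u = (1 : ℝ) := by
  rw [real_inner_self_eq_norm_sq, hu, one_pow]

theorem norm_coe_S2 (x : S2) : ‖(x : E3)‖ = 1 := norm_eq_of_mem_sphere x

theorem inner_self_S2 (x : S2) : inner ℝ (x : E3) x = (1 : ℝ) :=
  inner_self_eq_one (norm_coe_S2 x)

theorem neg_mem_greatCircle {x : S2} {u : E3} (hu : u ∈ greatCircle x) : -u ∈ greatCircle x :=
  ⟨by rw [norm_neg, hu.1], by rw [inner_neg_right, hu.2, neg_zero]⟩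

theorem angle_eq_arccos_inner {u v : E3} (hu : ‖u‖ = 1) (hv : ‖v‖ = 1) :
    angle u v = Real.arccos (inner ℝ u v) := by
  rw [angle, hu, hv, mul_one, div_one]

/-- The point at angle `θ` from `y` on the great circle with pole `x`, for `y` on that circle. -/
def circlePoint (x y : E3) (θ : ℝ) : E3 := Real.cos θ • y + Real.sin θ • cross x y

section CirclePoint

variable {x : S2} {y z : E3}

theorem circlePoint_sub_int_mul_two_pi (x y : E3) (θ : ℝ) (n : ℤ) :
    circlePoint x y (θ - n * (2 * Real.pi)) = circlePoint x y θ := by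
  rw [circlePoint, circlePoint, Real.cos_sub_int_mul_two_pi, Real.sin_sub_int_mul_two_pi]

theorem inner_circlePoint_circlePoint (hy : y ∈ greatCircle x) (θ θ' : ℝ) :
    inner ℝ (circlePoint x y θ) (circlePoint x y θ') = Real.cos (θ - θ') := by
  have horth : inner ℝ (cross x y) y = (0 : ℝ) := by rw [real_inner_comm, inner_right_cross]
  have hcross : inner ℝ (cross x y) (cross x y) = (1 : ℝ) := by
    rw [inner_cross_cross, inner_self_S2, inner_self_eq_one hy.1, hy.2]
    norm_num
  simp only [circlePoint, inner_add_left, inner_add_right, real_inner_smul_left,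
    real_inner_smul_right, horth, inner_right_cross, inner_self_eq_one hy.1, hcross, Real.cos_sub]
  ring

theorem circlePoint_mem_greatCircle (hy : y ∈ greatCircle x) (θ : ℝ) :
    circlePoint x y θ ∈ greatCircle x := by
  constructor
  · rw [norm_eq_sqrt_real_inner, inner_circlePoint_circlePoint hy, sub_self, Real.cos_zero,
      Real.sqrt_one]
  · rw [circlePoint, inner_add_right, real_inner_smul_right, real_inner_smul_right, hy.2,
      inner_left_cross, mul_zero, mul_zero, add_zero]

theorem angle_circlePoint_circlePoint (hy : y ∈ greatCircle x) {θ θ' : ℝ}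
    (hθ : |θ - θ'| ≤ Real.pi) :
    angle (circlePoint x y θ) (circlePoint x y θ') = |θ - θ'| := by
  rw [angle_eq_arccos_inner (circlePoint_mem_greatCircle hy θ).1
      (circlePoint_mem_greatCircle hy θ').1,
    inner_circlePoint_circlePoint hy, ← Real.cos_abs, Real.arccos_cos (abs_nonneg _) hθ]

theorem exists_circlePoint_eq (hy : y ∈ greatCircle x) (hz : z ∈ greatCircle x) :
    ∃ θ, circlePoint x y θ = z := by
  set c : ℝ := inner ℝ y z with hc
  set s : ℝ := inner ℝ (cross x y) z with hs
  have hcs : c ^ 2 + s ^ 2 = 1 := by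
    have hgram := inner_cross_sq x y z
    rw [inner_self_S2, inner_self_eq_one hy.1, inner_self_eq_one hz.1, hy.2, hz.2] at hgram
    rw [hs, hgram]
    ring
  obtain ⟨θ, hθ⟩ := (Complex.norm_eq_one_iff (⟨c, s⟩ : ℂ)).1 <| by
    rw [Complex.norm_def, Complex.normSq_mk, ← sq, ← sq, hcs, Real.sqrt_one]
  have hcos : Real.cos θ = c := by rw [← Complex.exp_ofReal_mul_I_re, hθ]
  have hsin : Real.sin θ = s := by rw [← Complex.exp_ofReal_mul_I_im, hθ]
  refine ⟨θ, (inner_eq_one_iff_of_norm_eq_one (𝕜 := ℝ)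
    (circlePoint_mem_greatCircle hy θ).1 hz.1).1 ?_⟩
  rw [circlePoint, inner_add_left, real_inner_smul_left, real_inner_smul_left, ← hc, ← hs, hcos,
    hsin, ← sq, ← sq, hcs]

end CirclePoint

section Lattice

variable {N : ℕ} (P : Placement N) (s : Config N) (i : Node N)

theorem latticePoint_mem_greatCircle (l : ZMod (latticeSize N)) :
    latticePoint P s i l ∈ greatCircle (s.pole i) :=
  circlePoint_mem_greatCircle (P.start_mem s i) _

variable [NeZero (latticeSize N)]

theorem latticePoint_intCast (r : ℤ) :
    latticePoint P s i (r : ZMod (latticeSize N)) =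
      circlePoint (s.pole i) (P.start s i) (2 * Real.pi * r / latticeSize N) := by
  have hm : (latticeSize N : ℝ) ≠ 0 := Nat.cast_ne_zero.2 (NeZero.ne _)
  have hval : (((r : ZMod (latticeSize N)).val : ℤ) : ℝ) =
      r - latticeSize N * ((r / latticeSize N : ℤ) : ℝ) := by
    rw [ZMod.val_intCast, Int.emod_def]
    push_cast
    ring
  rw [← circlePoint_sub_int_mul_two_pi _ _ (2 * Real.pi * r / latticeSize N)
    (r / latticeSize N), latticePoint, circlePoint, ← Int.cast_natCast, hval]
  congr 3 <;> field

theorem exists_angle_latticePoint_le {z : E3} (hz : z ∈ greatCircle (s.pole i)) :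
    ∃ l, angle (latticePoint P s i l) z ≤ Real.pi / latticeSize N := by
  have hm : (0 : ℝ) < latticeSize N := Nat.cast_pos.2 (NeZero.pos _)
  obtain ⟨φ, rfl⟩ := exists_circlePoint_eq (P.start_mem s i) hz
  set r : ℤ := round (φ * latticeSize N / (2 * Real.pi)) with hr
  have hscale : 2 * Real.pi * r / latticeSize N - φ =
      2 * Real.pi / latticeSize N * (r - φ * latticeSize N / (2 * Real.pi)) := by
    field_simp
  have hdist : |2 * Real.pi * r / latticeSize N - φ| ≤ Real.pi / latticeSize N := by
    rw [hscale, abs_mul, abs_of_pos (by positivity), hr, abs_sub_comm]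
    calc 2 * Real.pi / latticeSize N * _ ≤ 2 * Real.pi / latticeSize N * (1 / 2) :=
          mul_le_mul_of_nonneg_left (abs_sub_round _) (by positivity)
      _ = Real.pi / latticeSize N := by ring
  refine ⟨r, ?_⟩
  rwa [latticePoint_intCast, angle_circlePoint_circlePoint (P.start_mem s i)]
  exact hdist.trans (div_le_self Real.pi_pos.le (Nat.one_le_cast.2 NeZero.one_le))

theorem angle_latticePoint_latticePoint (l l' : ZMod (latticeSize N)) :
    angle (latticePoint P s i l) (latticePoint P s i l') =
      2 * Real.pi * |((l - l').valMinAbs : ℝ)| / latticeSize N := by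
  have hm : (0 : ℝ) < latticeSize N := Nat.cast_pos.2 (NeZero.pos _)
  set d := (l - l').valMinAbs with hd
  have hl' : ((l'.val : ℤ) : ZMod (latticeSize N)) = l' := by
    rw [Int.cast_natCast, ZMod.natCast_zmod_val]
  have hl : ((l'.val + d : ℤ) : ZMod (latticeSize N)) = l := by
    rw [Int.cast_add, hl', hd, ZMod.coe_valMinAbs, add_sub_cancel]
  have hdiff : |2 * Real.pi * ((l'.val + d : ℤ) : ℝ) / latticeSize N -
      2 * Real.pi * ((l'.val : ℤ) : ℝ) / latticeSize N| =
        2 * Real.pi * |(d : ℝ)| / latticeSize N := by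
    rw [Int.cast_add, ← sub_div, ← mul_sub, add_sub_cancel_left, abs_div, abs_mul,
      abs_of_pos Real.two_pi_pos, abs_of_pos hm]
  have hsmall : 2 * |(d : ℝ)| ≤ latticeSize N := by
    have : d.natAbs * 2 ≤ latticeSize N := by
      have := ZMod.natAbs_valMinAbs_le (l - l')
      omega
    rw [← Int.cast_abs, Int.abs_eq_natAbs]
    exact_mod_cast mul_comm 2 d.natAbs ▸ this
  have hle : 2 * Real.pi * |(d : ℝ)| / latticeSize N ≤ Real.pi := by
    rw [div_le_iff₀ hm]
    nlinarith [Real.pi_pos]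
  have hangle := angle_circlePoint_circlePoint (P.start_mem s i) (hdiff.trans_le hle)
  rwa [← latticePoint_intCast, ← latticePoint_intCast, hl, hl', hdiff] at hangle

theorem card_le_of_angle_latticePoint_le {q : ℕ} {z : E3} {ρ : ℝ}
    (hρ : 2 * ρ < 2 * Real.pi * (q + 1 : ℕ) / latticeSize N)
    {K : Finset (ZMod (latticeSize N))} (hK : ∀ l ∈ K, angle (latticePoint P s i l) z ≤ ρ) :
    K.card ≤ 2 * q + 1 := by
  have hm : (0 : ℝ) < latticeSize N := Nat.cast_pos.2 (NeZero.pos _)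
  rcases K.eq_empty_or_nonempty with rfl | ⟨l', hl'⟩
  · simp
  have hmaps : ∀ l ∈ K, (l - l').valMinAbs ∈ Finset.Icc (-q : ℤ) q := by
    intro l hl
    have hangle := (angle_le_angle_add_angle (latticePoint P s i l) z
      (latticePoint P s i l')).trans
        (add_le_add (hK l hl) ((angle_comm _ _).trans_le (hK l' hl')))
    rw [angle_latticePoint_latticePoint, ← two_mul] at hangle
    have hlt := hangle.trans_lt hρ
    rw [div_lt_div_iff_of_pos_right hm, mul_lt_mul_iff_right₀ Real.two_pi_pos] at hlt
    have : |(l - l').valMinAbs| < (q + 1 : ℕ) := by exact_mod_cast hlt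
    rw [Finset.mem_Icc, ← abs_le]
    omega
  refine (Finset.card_le_card_of_injOn _ hmaps fun a _ b _ hab => ?_).trans_eq ?_
  · exact sub_left_injective (ZMod.injective_valMinAbs hab)
  · rw [Int.card_Icc]
    omega

end Lattice

section Meet

theorem norm_crossing {x y : S2} (h : crossing x y ≠ 0) : ‖crossing x y‖ = 1 := by
  rw [crossing, smul_ne_zero_iff] at h
  rw [crossing, norm_smul, norm_inv, norm_norm, inv_mul_cancel₀ (norm_ne_zero_iff.2 h.2)]

theorem crossing_mem_greatCircle {x y : S2} (h : crossing x y ≠ 0) :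
    crossing x y ∈ greatCircle x ∩ greatCircle y := by
  refine ⟨⟨norm_crossing h, ?_⟩, norm_crossing h, ?_⟩
  · rw [crossing, real_inner_smul_right, inner_left_cross, mul_zero]
  · rw [crossing, real_inner_smul_right, inner_right_cross, mul_zero]

variable {N : ℕ} {s : Config N} {i j : Node N}

theorem Config.meetLt_mem_greatCircle (h : s.meetLt i j ≠ 0) :
    s.meetLt i j ∈ greatCircle (s.pole i) ∩ greatCircle (s.pole j) := by
  unfold meetLt at h ⊢
  split_ifs at h ⊢
  · exact crossing_mem_greatCircle h
  · have hmem := crossing_mem_greatCircle (neg_ne_zero.1 h)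
    exact ⟨neg_mem_greatCircle hmem.1, neg_mem_greatCircle hmem.2⟩

theorem Config.meet_mem_greatCircle (h : s.meet i j ≠ 0) :
    s.meet i j ∈ greatCircle (s.pole i) ∩ greatCircle (s.pole j) := by
  unfold meet at h ⊢
  split_ifs at h ⊢
  · exact meetLt_mem_greatCircle h
  · exact (meetLt_mem_greatCircle h).symm

end Meet

end GreatCircles

/-! ### Isolated pairs of neighbors -/

section IsolatedPairs

open InnerProductGeometry

variable {N : ℕ}

/-- The radius of the disks around the intersection points. -/
def diskRadius (Δ : ℝ) (N : ℕ) : ℝ := (2 + Δ) * √(Real.pi / ((2 * N : ℕ) : ℝ))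

/-- The angle at which the radius of the disks is seen from the center of the sphere. -/
def diskAngle (Δ : ℝ) (N : ℕ) : ℝ := 2 * Real.pi * (2 + Δ) / √((2 * N : ℕ) : ℝ)

theorem gdist_le_gdist_iff {u v u' v' : E3} :
    gdist u v ≤ gdist u' v' ↔ angle u v ≤ angle u' v' :=
  div_le_div_iff_of_pos_right (by positivity)

theorem gdist_le_diskRadius_iff (Δ : ℝ) (u z : E3) :
    gdist u z ≤ diskRadius Δ N ↔ angle u z ≤ diskAngle Δ N := by
  have hscale : diskRadius Δ N * (2 * √Real.pi) = diskAngle Δ N := by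
    rw [diskRadius, diskAngle, Real.sqrt_div Real.pi_pos.le]
    linear_combination (2 * (2 + Δ) / √((2 * N : ℕ) : ℝ)) * Real.mul_self_sqrt Real.pi_pos.le
  rw [gdist, div_le_iff₀ (by positivity), hscale]

theorem mem_disk_iff {Δ : ℝ} {u z : E3} :
    u ∈ disk z (diskRadius Δ N) ↔ ‖u‖ = 1 ∧ angle u z ≤ diskAngle Δ N := by
  rw [← gdist_le_diskRadius_iff]
  rfl

theorem latticeSize_le_sqrt : (latticeSize N : ℝ) ≤ √((2 * N : ℕ) : ℝ) :=
  Real.nat_sqrt_le_real_sqrt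

theorem sqrt_le_latticeSize_add_one : √((2 * N : ℕ) : ℝ) ≤ latticeSize N + 1 :=
  Real.real_sqrt_lt_nat_sqrt_succ.le

theorem one_add_mul_gdist_le {Δ η : ℝ} (hΔ : 0 ≤ Δ) {u v w z : E3} (hu : angle u z ≤ η)
    (hv : angle v z ≤ η) (hw : (3 + 2 * Δ) * η ≤ angle w z) :
    (1 + Δ) * gdist u v ≤ gdist w v := by
  have huv : angle u v ≤ 2 * η := by
    linarith [angle_le_angle_add_angle u z v, angle_comm z v]
  have hwv : (2 + 2 * Δ) * η ≤ angle w v := by linarith [angle_le_angle_add_angle w v z]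
  rw [gdist, gdist, ← mul_div_assoc]
  gcongr
  nlinarith

/-- Nodes `i` and `j` are neighbors, `i` has no other neighbor, and no node other than `i` and `j`
can disturb a transmission from `i` to `j`. -/
structure Isolated (Δ : ℝ) (P : Placement N) (ω : Sample N) (t : ℕ) (i j : Node N) : Prop where
  neighbor : Neighbor P ω t i j
  eq_of_neighbor : ∀ k, Neighbor P ω t i k → k = j
  far : ∀ k, k ≠ i → k ≠ j →
    (1 + Δ) * gdist (location P ω t i) (location P ω t j) ≤
      gdist (location P ω t k) (location P ω t j)

section Success

variable {Δ : ℝ} {P : Placement N} {ω : Sample N} {t : ℕ} {c : Fin N} {r : Node N}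

theorem Isolated.success_txA (h : Isolated Δ P ω t (ω.1.src c) r)
    (hcoins : ω.2.2 t ∈ coinsA (ω.1.src c) r) :
    Success Δ (location P ω t) (TxA P ω t) (ω.1.src c) r := by
  obtain ⟨⟨hact, hsend⟩, hsilent⟩ := hcoins
  refine ⟨⟨⟨c, rfl⟩, hact, hsend, h.neighbor, fun k hk => ?_⟩, fun k hk hT => h.far k hk ?_⟩
  · rw [h.eq_of_neighbor k hk]
  · rintro rfl
    obtain ⟨_, _, hact', _⟩ := hT
    exact Bool.false_ne_true (hsilent.symm.trans hact')

theorem Isolated.success_txB {q : Node N → Fin N → ℕ} (h : Isolated Δ P ω t r (ω.1.dst c))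
    (hcoins : ω.2.2 t ∈ coinsB r (ω.1.dst c)) (hq : 0 < q r c) :
    Success Δ (location P ω t) (TxB P ω t q) r (ω.1.dst c) := by
  obtain ⟨hact, hsilent⟩ := hcoins
  refine ⟨⟨hact, ⟨⟨h.neighbor, c, rfl⟩, fun k hk => ?_⟩, c, rfl, hq⟩, fun k hk hT => h.far k hk ?_⟩
  · rw [h.eq_of_neighbor k hk.1]
  · rintro rfl
    obtain ⟨_, hact', _⟩ := hT
    exact Bool.false_ne_true (hsilent.symm.trans hact')

end Success

variable [NeZero (latticeSize N)]

theorem diskAngle_le {Δ : ℝ} (hΔ : 0 ≤ Δ) :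
    diskAngle Δ N ≤ 2 * Real.pi * (2 + Δ) / latticeSize N := by
  have hm : (0 : ℝ) < latticeSize N := Nat.cast_pos.2 (NeZero.pos _)
  have := latticeSize_le_sqrt (N := N)
  unfold diskAngle
  gcongr

theorem le_diskAngle {Δ : ℝ} (hΔ : 0 ≤ Δ) (hm : 3 + 2 * Δ ≤ latticeSize N) :
    (3 + 2 * Δ) * (Real.pi / latticeSize N) ≤ diskAngle Δ N := by
  have hm0 : (0 : ℝ) < latticeSize N := Nat.cast_pos.2 (NeZero.pos _)
  rw [diskAngle, ← mul_div_assoc, div_le_div_iff₀ hm0 (hm0.trans_le latticeSize_le_sqrt)]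
  have hsqrt : (3 + 2 * Δ) * √((2 * N : ℕ) : ℝ) ≤ 2 * (2 + Δ) * latticeSize N :=
    calc (3 + 2 * Δ) * √((2 * N : ℕ) : ℝ) ≤ (3 + 2 * Δ) * (latticeSize N + 1) :=
          mul_le_mul_of_nonneg_left sqrt_le_latticeSize_add_one (by linarith)
      _ ≤ 2 * (2 + Δ) * latticeSize N := by linarith
  nlinarith [mul_le_mul_of_nonneg_left hsqrt Real.pi_pos.le]

variable {P : Placement N} {ω : Sample N} {t : ℕ} {i j k : Node N} {z : E3}

theorem AtClosest.angle_location_le (hclosest : AtClosest P ω t i z)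
    (hz : z ∈ greatCircle (ω.1.pole i)) :
    angle (location P ω t i) z ≤ Real.pi / latticeSize N := by
  obtain ⟨l, hl⟩ := exists_angle_latticePoint_le P ω.1 i hz
  exact (gdist_le_gdist_iff.1 (hclosest l)).trans hl

theorem Neighbor.angle_location_le (hneighbor : Neighbor P ω t i k)
    (hne : ω.1.meet i k ≠ 0) :
    angle (location P ω t k) z ≤
      angle (location P ω t i) z + 2 * (Real.pi / latticeSize N) := by
  obtain ⟨-, hi, hk⟩ := hneighbor
  have hmem := Config.meet_mem_greatCircle hne
  linarith [hi.angle_location_le hmem.1, hk.angle_location_le hmem.2,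
    angle_le_angle_add_angle (location P ω t k) (ω.1.meet i k) z,
    angle_le_angle_add_angle (ω.1.meet i k) (location P ω t i) z,
    angle_comm (ω.1.meet i k) (location P ω t i)]

open Classical in
/-- The lattice points of node `k` that lie in the disk around `z i j`. -/
def nearPoints (Δ : ℝ) (P : Placement N) (s : Config N) (i j k : Node N) :
    Finset (ZMod (latticeSize N)) :=
  Finset.univ.filter fun l => angle (latticePoint P s k l) (s.meet i j) ≤ diskAngle Δ N

/-- A bound for the number of lattice points of a node in a disk. -/
def nearBound (Δ : ℝ) : ℕ := 2 * ⌊2 * (2 + Δ)⌋₊ + 1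

theorem card_nearPoints_le {Δ : ℝ} (hΔ : 0 ≤ Δ) (P : Placement N) (s : Config N)
    (i j k : Node N) : (nearPoints Δ P s i j k).card ≤ nearBound Δ := by
  refine card_le_of_angle_latticePoint_le P s k (z := s.meet i j) (ρ := diskAngle Δ N) ?_
    fun l hl => (Finset.mem_filter.1 hl).2
  have hm : (0 : ℝ) < latticeSize N := Nat.cast_pos.2 (NeZero.pos _)
  have hfloor := Nat.lt_floor_add_one (2 * (2 + Δ))
  calc 2 * diskAngle Δ N ≤ 2 * (2 * Real.pi * (2 + Δ) / latticeSize N) := by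
        gcongr
        exact diskAngle_le hΔ
    _ = 2 * Real.pi * (2 * (2 + Δ)) / latticeSize N := by ring
    _ < _ := by
        push_cast
        gcongr

open Classical in
theorem card_nonempty_nearPoints_le (Δ : ℝ) (P : Placement N) (s : Config N) (i j : Node N) :
    (Finset.univ.filter fun k => (nearPoints Δ P s i j k).Nonempty).card ≤
      s.crossingCount Δ i j := by
  unfold Config.crossingCount
  refine Finset.card_le_card fun k hk => ?_
  obtain ⟨l, hl⟩ := (Finset.mem_filter.1 hk).2
  have hmem := latticePoint_mem_greatCircle P s k l
  exact Finset.mem_filter.2 ⟨Finset.mem_univ _, latticePoint P s k l, hmem,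
    mem_disk_iff.2 ⟨hmem.1, (Finset.mem_filter.1 hl).2⟩⟩

theorem isolated_of_pos_mem {Δ : ℝ} (hΔ : 0 ≤ Δ) (hm : 3 + 2 * Δ ≤ latticeSize N)
    (hne : ∀ i j : Node N, i ≠ j → ω.1.meet i j ≠ 0) (hij : i ≠ j)
    {u v : ZMod (latticeSize N)}
    (hu : ∀ l, gdist (latticePoint P ω.1 i u) (ω.1.meet i j) ≤
      gdist (latticePoint P ω.1 i l) (ω.1.meet i j))
    (hv : ∀ l, gdist (latticePoint P ω.1 j v) (ω.1.meet i j) ≤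
      gdist (latticePoint P ω.1 j l) (ω.1.meet i j))
    (hpos : pos ω t ∈ isolatedPositions i j u v (nearPoints Δ P ω.1 i j)) :
    Isolated Δ P ω t i j := by
  obtain ⟨rfl, rfl, havoid⟩ := (mem_isolatedPositions hij).1 hpos
  have hmem := Config.meet_mem_greatCircle (hne i j hij)
  have hi : AtClosest P ω t i (ω.1.meet i j) := hu
  have hj : AtClosest P ω t j (ω.1.meet i j) := hv
  have hfar : ∀ k, k ≠ i → k ≠ j →
      (3 + 2 * Δ) * (Real.pi / latticeSize N) < angle (location P ω t k) (ω.1.meet i j) := by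
    intro k hki hkj
    refine (le_diskAngle hΔ hm).trans_lt (not_le.1 fun hle => ?_)
    exact havoid k hki hkj (Finset.mem_filter.2 ⟨Finset.mem_univ _, hle⟩)
  refine ⟨⟨hij, hi, hj⟩, fun k hneighbor => ?_, fun k hki hkj => ?_⟩
  · by_contra hkj
    have hnear := hneighbor.angle_location_le (z := ω.1.meet i j) (hne i k hneighbor.1)
    have hi' := hi.angle_location_le hmem.1
    have hη : 0 ≤ Real.pi / latticeSize N := by positivity
    nlinarith [hfar k hneighbor.1.symm hkj]
  · exact one_add_mul_gdist_le hΔ (hi.angle_location_le hmem.1) (hj.angle_location_le hmem.2)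
      (hfar k hki hkj).le

end IsolatedPairs

/-! ### Throughput in a typical configuration -/

section TypicalThroughput

open InnerProductGeometry

theorem exp_neg_two_mul_le_one_sub {x : ℝ} (hx0 : 0 ≤ x) (hx : x ≤ 1 / 2) :
    Real.exp (-(2 * x)) ≤ 1 - x := by
  rw [Real.exp_neg, inv_le_comm₀ (Real.exp_pos _) (by linarith)]
  refine le_trans ?_ (Real.add_one_le_exp (2 * x))
  rw [inv_le_iff_one_le_mul₀ (by linarith)]
  nlinarith

theorem exp_le_one_sub_div_pow {q β : ℕ} {m b : ℝ} (hm : 1 ≤ m) (hq : 2 * (q : ℝ) ≤ m)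
    (hβ : (β : ℝ) ≤ b * (m + 1)) (hb : 0 ≤ b) :
    Real.exp (-(4 * q * b)) ≤ (1 - q / m) ^ β := by
  have hx : (q : ℝ) / m ≤ 1 / 2 := by
    rw [div_le_div_iff₀ (by linarith) two_pos]
    linarith
  have hβ' : (β : ℝ) * (q / m) ≤ 2 * b * q :=
    calc (β : ℝ) * (q / m) ≤ 2 * b * m * (q / m) := by
          gcongr
          nlinarith
      _ = 2 * b * q := by field_simp
  calc Real.exp (-(4 * q * b)) ≤ Real.exp (β * -(2 * (q / m))) :=
        Real.exp_le_exp.2 (by linarith)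
    _ = Real.exp (-(2 * (q / m))) ^ β := Real.exp_nat_mul _ _
    _ ≤ (1 - q / m) ^ β :=
        pow_le_pow_left₀ (Real.exp_pos _).le (exp_neg_two_mul_le_one_sub (by positivity) hx) _

theorem four_mul_lt_two_mul_nearBound {Δ : ℝ} (hΔ : 0 ≤ Δ) :
    4 * (2 + Δ) < (2 * nearBound Δ : ℕ) := by
  have hfloor := Nat.lt_floor_add_one (2 * (2 + Δ))
  rw [nearBound]
  push_cast
  linarith

variable {N : ℕ} [NeZero (latticeSize N)]

theorem Config.Typical.meet_ne_zero {Δ a b : ℝ} (hΔ : 0 ≤ Δ) (ha : 0 < a)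
    (hm : 4 * (2 + Δ) < latticeSize N) {s : Config N} (hs : s.Typical Δ a b) {i j : Node N}
    (hij : i ≠ j) : s.meet i j ≠ 0 := by
  classical
  intro hzero
  have hm0 : (0 : ℝ) < latticeSize N := Nat.cast_pos.2 (NeZero.pos _)
  have hcount : 0 < s.crossingCount Δ i j := by
    exact_mod_cast (mul_pos ha (hm0.trans_le latticeSize_le_sqrt)).trans_le (hs i j hij).1
  unfold crossingCount at hcount
  obtain ⟨k, hk⟩ := Finset.card_pos.1 hcount
  obtain ⟨u, -, hu⟩ := (Finset.mem_filter.1 hk).2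
  have hangle := (mem_disk_iff.1 hu).2.trans (diskAngle_le hΔ)
  -- The angle to the zero vector is `π / 2` by convention.
  rw [hzero, angle_zero_right, div_le_div_iff₀ two_pos hm0] at hangle
  nlinarith [Real.pi_pos]

open Classical in
/-- The pairs of joint positions and favorable coins have their stationary frequencies. -/
def RegularFrequencies (p α : unitInterval) (ω : Sample N) : Prop :=
  ∀ (i j : Node N) (U : Finset (Node N → ZMod (latticeSize N))), i ≠ j →
    Tendsto (fun t : ℕ => ((∑ τ ∈ Finset.range t,
      if pos ω τ ∈ U ∧ ω.2.2 τ ∈ coinsA i j then 1 else 0 : ℕ) : ℝ) / t)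
      atTop (𝓝 (U.card / (latticeSize N : ℝ) ^ (2 * N) * (p * α * (1 - p)))) ∧
    Tendsto (fun t : ℕ => ((∑ τ ∈ Finset.range t,
      if pos ω τ ∈ U ∧ ω.2.2 τ ∈ coinsB i j then 1 else 0 : ℕ) : ℝ) / t)
      atTop (𝓝 (U.card / (latticeSize N : ℝ) ^ (2 * N) * (p * (1 - p))))

theorem ae_regularFrequencies (p α : unitInterval) :
    ∀ᵐ ω ∂(law p α N), RegularFrequencies p α ω := by
  refine ae_all_iff.2 fun i => ae_all_iff.2 fun j => ae_all_iff.2 fun U => ?_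
  by_cases hij : i = j
  · exact Eventually.of_forall fun ω h => absurd hij h
  · filter_upwards [ae_tendsto_frequency p α U (coinsA i j),
      ae_tendsto_frequency p α U (coinsB i j)] with ω hA hB _
    rw [pi_noiseMeasure_real_coinsA p α hij] at hA
    rw [pi_noiseMeasure_real_coinsB p α hij] at hB
    exact ⟨hA, hB⟩

variable {Δ a b : ℝ} {p α : unitInterval} {P : Placement N} {ω : Sample N}

theorem le_frequency_isolated (hΔ : 0 ≤ Δ) (hb : 0 ≤ b)
    (hlarge : 2 * nearBound Δ ≤ latticeSize N) (P : Placement N) {s : Config N}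
    (hs : s.Typical Δ a b) {i j : Node N} (hij : i ≠ j) (u v : ZMod (latticeSize N)) :
    Real.exp (-(4 * nearBound Δ * b)) / (2 * N : ℕ) ≤
      (isolatedPositions i j u v (nearPoints Δ P s i j)).card /
        (latticeSize N : ℝ) ^ (2 * N) := by
  classical
  have hm : (1 : ℝ) ≤ latticeSize N := Nat.one_le_cast.2 NeZero.one_le
  have hlarge' : 2 * (nearBound Δ : ℝ) ≤ latticeSize N := by exact_mod_cast hlarge
  have hβ : (s.crossingCount Δ i j : ℝ) ≤ b * (latticeSize N + 1) :=
    (hs i j hij).2.trans (mul_le_mul_of_nonneg_left sqrt_le_latticeSize_add_one hb)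
  have hsq : (latticeSize N : ℝ) ^ 2 ≤ (2 * N : ℕ) := by
    exact_mod_cast (Nat.sqrt_le' (2 * N) : latticeSize N ^ 2 ≤ 2 * N)
  have hexp := exp_le_one_sub_div_pow hm hlarge' hβ hb
  calc Real.exp (-(4 * nearBound Δ * b)) / (2 * N : ℕ)
      ≤ (1 - nearBound Δ / latticeSize N : ℝ) ^ s.crossingCount Δ i j / latticeSize N ^ 2 :=
        div_le_div₀ ((Real.exp_pos _).le.trans hexp) hexp (by positivity) hsq
    _ ≤ _ := le_card_isolatedPositions hij u v (card_nearPoints_le hΔ P s i j) (by omega)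
        (card_nonempty_nearPoints_le Δ P s i j)

theorem exists_isolating_positions (hΔ : 0 ≤ Δ) (ha : 0 < a) (hb : 0 ≤ b)
    (hlarge : 2 * nearBound Δ ≤ latticeSize N) (P : Placement N) (hs : ω.1.Typical Δ a b)
    {i j : Node N} (hij : i ≠ j) :
    ∃ U : Finset (Node N → ZMod (latticeSize N)),
      Real.exp (-(4 * nearBound Δ * b)) / (2 * N : ℕ) ≤
        U.card / (latticeSize N : ℝ) ^ (2 * N) ∧
      ∀ t, pos ω t ∈ U → Isolated Δ P ω t i j := by
  have hm : 4 * (2 + Δ) < latticeSize N :=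
    (four_mul_lt_two_mul_nearBound hΔ).trans_le (Nat.cast_le.2 hlarge)
  obtain ⟨u, hu⟩ := Finite.exists_min fun l => gdist (latticePoint P ω.1 i l) (ω.1.meet i j)
  obtain ⟨v, hv⟩ := Finite.exists_min fun l => gdist (latticePoint P ω.1 j l) (ω.1.meet i j)
  exact ⟨isolatedPositions i j u v (nearPoints Δ P ω.1 i j),
    le_frequency_isolated hΔ hb hlarge P hs hij u v, fun t =>
      isolated_of_pos_mem hΔ (by linarith) (fun _ _ => hs.meet_ne_zero hΔ ha hm) hij hu hv⟩

/-- `rateConst / n` is a lower bound for the stationary frequency of the time-slots in which a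
given pair of nodes is isolated, and both of its coins favor a transmission. -/
def rateConst (Δ b : ℝ) (p α : unitInterval) : ℝ :=
  Real.exp (-(4 * nearBound Δ * b)) * (p * α * (1 - p))

theorem rateConst_pos (Δ b : ℝ) {p α : unitInterval} (hp : 0 < p) (hp1 : p < 1) (hα : 0 < α) :
    0 < rateConst Δ b p α :=
  mul_pos (Real.exp_pos _) (mul_pos (mul_pos hp hα) (sub_pos.2 hp1))

theorem rateConst_div_lt (hp : 0 < p) (hp1 : p < 1) (hα : 0 < α) {x : ℝ}
    (hx : Real.exp (-(4 * nearBound Δ * b)) / (2 * N : ℕ) ≤ x) :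
    rateConst Δ b p α / (4 * N) < x * (p * α * (1 - p)) := by
  have hN : 0 < N := by
    have : N ≠ 0 := by
      rintro rfl
      exact NeZero.ne (latticeSize 0) rfl
    omega
  have hpos := rateConst_pos Δ b hp hp1 hα
  have hcoins : (0 : ℝ) ≤ p * α * (1 - p) :=
    mul_nonneg (mul_nonneg p.2.1 α.2.1) (sub_nonneg.2 p.2.2)
  calc rateConst Δ b p α / (4 * N) < rateConst Δ b p α / (2 * N) :=
        div_lt_div_of_pos_left hpos (by positivity) (by gcongr; norm_num)
    _ = Real.exp (-(4 * nearBound Δ * b)) / (2 * N : ℕ) * (p * α * (1 - p)) := by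
        rw [rateConst, Nat.cast_mul, Nat.cast_two]
        ring
    _ ≤ x * (p * α * (1 - p)) := mul_le_mul_of_nonneg_right hx hcoins

theorem eventually_le_sum_departures (hΔ : 0 ≤ Δ) (ha : 0 < a) (hb : 0 ≤ b)
    (hlarge : 2 * nearBound Δ ≤ latticeSize N) (hp : 0 < p) (hp1 : p < 1) (hα : 0 < α)
    (hs : ω.1.Typical Δ a b) (hreg : RegularFrequencies p α ω) {c : Fin N} {r : Node N}
    (hsrc : ω.1.src c ≠ r)
    (hdst : r ≠ ω.1.dst c) :
    ∀ᶠ t : ℕ in atTop, rateConst Δ b p α / (4 * N) * t ≤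
      ((∑ τ ∈ Finset.range t, departures Δ P ω r c τ : ℕ) : ℝ) := by
  classical
  obtain ⟨U, hU, hisoU⟩ := exists_isolating_positions hΔ ha hb hlarge P hs hsrc
  obtain ⟨V, hV, hisoV⟩ := exists_isolating_positions hΔ ha hb hlarge P hs hdst
  refine eventually_mul_le_sum_dep (q := fun t => queue Δ P ω t r c)
    (arr := arrivals Δ P ω r c) rfl (queue_succ_add_departures Δ P ω r c) (fun t => ?_)
    (fun t ht => ?_) (hreg _ _ U hsrc).1 (hreg _ _ V hdst).2
    (rateConst_div_lt hp hp1 hα hU) ((rateConst_div_lt hp hp1 hα hV).trans_le ?_)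
  · split_ifs with h
    · rw [arrivals, if_pos ⟨(hisoU t h.1).success_txA h.2, hdst⟩]
    · exact Nat.zero_le _
  · split_ifs with h
    · rw [departures, if_pos ((hisoV t h.1).success_txB h.2 ht)]
    · exact Nat.zero_le _
  · have hpα : (p : ℝ) * α ≤ p := mul_le_of_le_one_right p.2.1 α.2.2
    have hp1' : (0 : ℝ) ≤ 1 - p := sub_nonneg.2 p.2.2
    gcongr

theorem eventually_le_sum_delivered (hΔ : 0 ≤ Δ) (ha : 0 < a) (hb : 0 ≤ b)
    (hlarge : 2 * nearBound Δ ≤ latticeSize N) (hp : 0 < p) (hp1 : p < 1) (hα : 0 < α)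
    (hs : ω.1.Typical Δ a b) (hreg : RegularFrequencies p α ω) (hN : 2 ≤ N) (c : Fin N) :
    ∀ᶠ t : ℕ in atTop, rateConst Δ b p α / 4 * t ≤
      ((∑ τ ∈ Finset.range t, delivered Δ P ω τ c : ℕ) : ℝ) := by
  classical
  let relays : Finset (Node N) := {ω.1.src c, ω.1.dst c}ᶜ
  have hcard : N ≤ relays.card := by
    rw [Finset.card_compl, Finset.card_pair (ω.1.src_ne_dst c c), Fintype.card_fin]
    omega
  have hrelays : ∀ᶠ t : ℕ in atTop, ∀ r ∈ relays, rateConst Δ b p α / (4 * N) * t ≤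
      ((∑ τ ∈ Finset.range t, departures Δ P ω r c τ : ℕ) : ℝ) := by
    refine (Filter.eventually_all_finset relays).2 fun r hr => ?_
    obtain ⟨hsrc, hdst⟩ : r ≠ ω.1.src c ∧ r ≠ ω.1.dst c := by simpa [relays] using hr
    exact eventually_le_sum_departures hΔ ha hb hlarge hp hp1 hα hs hreg hsrc.symm hdst
  have hpos := rateConst_pos Δ b hp hp1 hα
  filter_upwards [hrelays] with t ht
  calc rateConst Δ b p α / 4 * t = N * (rateConst Δ b p α / (4 * N) * t) := by
        have : (0 : ℝ) < N := by
          have : 0 < N := by omega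
          exact_mod_cast this
        field_simp
    _ ≤ relays.card * (rateConst Δ b p α / (4 * N) * t) := by gcongr
    _ = ∑ r ∈ relays, rateConst Δ b p α / (4 * N) * t := by
        rw [Finset.sum_const, nsmul_eq_mul]
    _ ≤ ∑ r ∈ relays, ((∑ τ ∈ Finset.range t, departures Δ P ω r c τ : ℕ) : ℝ) :=
        Finset.sum_le_sum ht
    _ ≤ _ := by exact_mod_cast sum_departures_le_sum_delivered Δ P ω c relays t

theorem le_liminf_bitsPi_of_typical (hΔ : 0 ≤ Δ) (ha : 0 < a) (hb : 0 ≤ b)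
    (hlarge : 2 * nearBound Δ ≤ latticeSize N) (hp : 0 < p) (hp1 : p < 1) (hα : 0 < α)
    (hs : ω.1.Typical Δ a b) (hreg : RegularFrequencies p α ω) {W : ℝ} (hW : 0 ≤ W) (hN : 2 ≤ N)
    (c : Fin N) :
    W * rateConst Δ b p α / 8 ≤ liminf (fun t : ℕ => bitsPi Δ W a b P ω c t / t) atTop := by
  refine le_liminf_bitsPi_div Δ P ω hW a b c ?_
  filter_upwards [eventually_le_sum_delivered (P := P) hΔ ha hb hlarge hp hp1 hα hs hreg hN c,
    eventually_gt_atTop 0] with t ht htpos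
  rw [le_div_iff₀ (Nat.cast_pos.2 htpos), bitsPi, if_pos hs, bitsSigma]
  linarith [mul_le_mul_of_nonneg_left ht (show 0 ≤ W / 2 by positivity)]

end TypicalThroughput

/-! ### The uniform measure of bands around great circles -/

section Bands

open scoped Pointwise

theorem exists_orthonormalBasis_apply_eq {E ι : Type*} [NormedAddCommGroup E]
    [InnerProductSpace ℝ E] [FiniteDimensional ℝ E] [Fintype ι]
    (hcard : Module.finrank ℝ E = Fintype.card ι) (i : ι) {z : E} (hz : ‖z‖ = 1) :
    ∃ b : OrthonormalBasis ι ℝ E, b i = z := by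
  have hsingleton : Orthonormal ℝ (({i} : Set ι).domRestrict fun _ => z) :=
    ⟨fun _ => hz, fun j k hjk => absurd (Subsingleton.elim j k) hjk⟩
  obtain ⟨b, hb⟩ := hsingleton.exists_orthonormalBasis_extension_of_card_eq hcard
  exact ⟨b, hb i rfl⟩

theorem volume_box {E ι : Type*} [NormedAddCommGroup E] [InnerProductSpace ℝ E]
    [FiniteDimensional ℝ E] [MeasurableSpace E] [BorelSpace E] [Fintype ι]
    (b : OrthonormalBasis ι ℝ E) (l u : ι → ℝ) :
    volume {y : E | ∀ i, inner ℝ (b i) y ∈ Set.Icc (l i) (u i)} =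
      ∏ i, ENNReal.ofReal (u i - l i) := by
  have hrepr := (PiLp.volume_preserving_ofLp ι).comp b.measurePreserving_repr
  have hpreimage : {y : E | ∀ i, inner ℝ (b i) y ∈ Set.Icc (l i) (u i)} =
      (WithLp.ofLp ∘ b.repr) ⁻¹' Set.univ.pi fun i => Set.Icc (l i) (u i) := by
    ext y
    simp only [Set.mem_ofPred_eq, Set.mem_preimage, Set.mem_univ_pi, Function.comp_apply,
      OrthonormalBasis.repr_apply_apply]
  rw [hpreimage, hrepr.measure_preimage
    (MeasurableSet.univ_pi fun _ => measurableSet_Icc).nullMeasurableSet, volume_pi_pi]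
  simp only [Real.volume_Icc]

theorem sphereUniform_apply {s : Set S2} (hs : MeasurableSet s) :
    sphereUniform s = (volume (Metric.ball (0 : E3) 1))⁻¹ *
      volume (Set.Ioo (0 : ℝ) 1 • ((↑) '' s : Set E3)) := by
  rw [sphereUniform, Measure.smul_apply, smul_eq_mul, Measure.toSphere_apply_univ,
    Measure.toSphere_apply' _ hs, ENNReal.mul_inv (by simp) (by simp), mul_mul_mul_comm,
    ENNReal.inv_mul_cancel (by simp) (by simp), one_mul]

/-- The band around the great circle with pole `z`, of half-width about `ε`. It consists of the
poles of the great circles that come within an angle of about `ε` of `z`. -/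
def band (z : E3) (ε : ℝ) : Set S2 := {x | |inner ℝ (x : E3) z| ≤ ε}

theorem band_neg (z : E3) (ε : ℝ) : band (-z) ε = band z ε := by
  simp only [band, inner_neg_right, abs_neg]

theorem measurableSet_band (z : E3) (ε : ℝ) : MeasurableSet (band z ε) :=
  measurableSet_le (by fun_prop) measurable_const

theorem mem_cone_band {z y : E3} {ε : ℝ} (hpos : 0 < ‖y‖) (hlt : ‖y‖ < 1)
    (hy : |inner ℝ z y| ≤ ε * ‖y‖) : y ∈ Set.Ioo (0 : ℝ) 1 • ((↑) '' band z ε : Set E3) := by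
  have hunit : ‖‖y‖⁻¹ • y‖ = 1 := by rw [norm_smul, norm_inv, norm_norm, inv_mul_cancel₀ hpos.ne']
  refine ⟨‖y‖, ⟨hpos, hlt⟩, ‖y‖⁻¹ • y,
    ⟨⟨‖y‖⁻¹ • y, mem_sphere_zero_iff_norm.2 hunit⟩, ?_, rfl⟩, smul_inv_smul₀ hpos.ne' y⟩
  change |inner ℝ (‖y‖⁻¹ • y) z| ≤ ε
  rwa [real_inner_smul_left, abs_mul, abs_of_pos (inv_pos.2 hpos), real_inner_comm,
    inv_mul_le_iff₀' hpos]

theorem volume_cone_band_le {z : E3} (hz : ‖z‖ = 1) {ε : ℝ} (hε : 0 ≤ ε) :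
    volume (Set.Ioo (0 : ℝ) 1 • ((↑) '' band z ε : Set E3)) ≤ ENNReal.ofReal (8 * ε) := by
  obtain ⟨b, hb⟩ := exists_orthonormalBasis_apply_eq (by simp) (0 : Fin 3) hz
  have hbox := volume_box b ![-ε, -1, -1] ![ε, 1, 1]
  have hprod : ∏ i, ENNReal.ofReal ((![ε, 1, 1] : Fin 3 → ℝ) i - (![-ε, -1, -1] : Fin 3 → ℝ) i) =
      ENNReal.ofReal (8 * ε) := by
    simp only [Fin.prod_univ_three, Matrix.cons_val_zero, Matrix.cons_val_one, Matrix.cons_val]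
    rw [← ENNReal.ofReal_mul (by linarith), ← ENNReal.ofReal_mul (by linarith)]
    congr 1
    ring
  rw [hprod] at hbox
  rw [← hbox]
  refine measure_mono ?_
  rintro _ ⟨r, hr, _, ⟨x, hx : |inner ℝ (x : E3) z| ≤ ε, rfl⟩, rfl⟩
  have hr1 : |r| ≤ 1 := (abs_of_pos hr.1).trans_le hr.2.le
  have hone (i) : |inner ℝ (b i) (r • (x : E3))| ≤ 1 := by
    refine (abs_real_inner_le_norm _ _).trans ?_
    rwa [b.norm_eq_one, norm_smul, norm_coe_S2, mul_one, one_mul]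
  have hzero : |inner ℝ (b 0) (r • (x : E3))| ≤ ε := by
    rw [hb, real_inner_smul_right, abs_mul, real_inner_comm]
    exact (mul_le_of_le_one_left (abs_nonneg _) hr1).trans hx
  intro i
  fin_cases i
  exacts [abs_le.1 hzero, abs_le.1 (hone 1), abs_le.1 (hone 2)]

theorem le_volume_cone_band {z : E3} (hz : ‖z‖ = 1) {ε : ℝ} (hε : 0 ≤ ε) (hε1 : ε ≤ 1) :
    ENNReal.ofReal (ε / 16) ≤ volume (Set.Ioo (0 : ℝ) 1 • ((↑) '' band z ε : Set E3)) := by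
  obtain ⟨b, hb⟩ := exists_orthonormalBasis_apply_eq (by simp) (0 : Fin 3) hz
  have hbox := volume_box b ![-(ε / 4), 1 / 4, 0] ![ε / 4, 1 / 2, 1 / 2]
  have hprod : ∏ i, ENNReal.ofReal ((![ε / 4, 1 / 2, 1 / 2] : Fin 3 → ℝ) i -
      (![-(ε / 4), 1 / 4, 0] : Fin 3 → ℝ) i) = ENNReal.ofReal (ε / 16) := by
    simp only [Fin.prod_univ_three, Matrix.cons_val_zero, Matrix.cons_val_one, Matrix.cons_val]
    rw [← ENNReal.ofReal_mul (by linarith), ← ENNReal.ofReal_mul (by nlinarith)]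
    congr 1
    ring
  rw [hprod] at hbox
  rw [← hbox]
  refine measure_mono fun y hy => ?_
  have hy0 : |inner ℝ z y| ≤ ε / 4 := hb ▸ abs_le.2 (hy 0)
  have hy1 : inner ℝ (b 1) y ∈ Set.Icc (1 / 4 : ℝ) (1 / 2) := hy 1
  have hy2 : inner ℝ (b 2) y ∈ Set.Icc (0 : ℝ) (1 / 2) := hy 2
  have hge : 1 / 4 ≤ ‖y‖ := by
    have hCS := real_inner_le_norm (b 1) y
    rw [b.norm_eq_one, one_mul] at hCS
    exact hy1.1.trans hCS
  have hlt : ‖y‖ < 1 := by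
    rw [← sq_lt_one_iff₀ (norm_nonneg y), ← b.sum_sq_norm_inner_right y]
    simp only [Fin.sum_univ_three, Real.norm_eq_abs, sq_abs, hb]
    have hsq0 : inner ℝ z y ^ 2 ≤ (1 / 4 : ℝ) ^ 2 := sq_le_sq.2 (hy0.trans (by norm_num; linarith))
    nlinarith [hy1.1, hy1.2, hy2.1, hy2.2]
  exact mem_cone_band (by linarith) hlt (hy0.trans (by nlinarith))

theorem exists_sphereUniform_band_bounds : ∃ C₀ C₁ : ℝ, 0 < C₀ ∧ 0 < C₁ ∧
    (∀ z : E3, ‖z‖ = 1 → ∀ ε : ℝ, 0 ≤ ε → sphereUniform.real (band z ε) ≤ C₁ * ε) ∧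
    ∀ z : E3, ‖z‖ = 1 → ∀ ε : ℝ, 0 ≤ ε → ε ≤ 1 → C₀ * ε ≤ sphereUniform.real (band z ε) := by
  set V := volume (Metric.ball (0 : E3) 1) with hV
  have hV0 : 0 < V.toReal :=
    ENNReal.toReal_pos (Metric.measure_ball_pos volume _ one_pos).ne' measure_ball_lt_top.ne
  have hreal (z : E3) (ε : ℝ) : sphereUniform.real (band z ε) =
      V.toReal⁻¹ * (volume (Set.Ioo (0 : ℝ) 1 • ((↑) '' band z ε : Set E3))).toReal := by
    rw [measureReal_def, sphereUniform_apply (measurableSet_band z ε), ← hV, ENNReal.toReal_mul,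
      ENNReal.toReal_inv]
  refine ⟨V.toReal⁻¹ / 16, V.toReal⁻¹ * 8, by positivity, by positivity, ?_, ?_⟩
  · intro z hz ε hε
    rw [hreal, mul_assoc]
    gcongr
    exact ENNReal.toReal_le_of_le_ofReal (by positivity) (volume_cone_band_le hz hε)
  · intro z hz ε hε hε1
    rw [hreal, div_mul_eq_mul_div, mul_div_assoc]
    gcongr
    exact (ENNReal.ofReal_le_iff_le_toReal
      (ne_top_of_le_ne_top ENNReal.ofReal_ne_top (volume_cone_band_le hz hε))).1
      (le_volume_cone_band hz hε hε1)

end Bands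

/-! ### Concentration of counts -/

section HitCount

variable {ι X : Type*} [Fintype ι]

open Classical in
/-- The number of coordinates of `y` that lie in `S`; a binomial variable if the coordinates
are i.i.d. -/
def hitCount (S : Set X) (y : ι → X) : ℕ :=
  (Finset.univ.filter fun k => y k ∈ S).card

theorem exp_mul_hitCount (t : ℝ) (S : Set X) (y : ι → X) :
    Real.exp (t * hitCount S y) = ∏ k, (S.indicator (fun _ => Real.exp t - 1) (y k) + 1) := by
  classical
  have hfactor (k) : S.indicator (fun _ => Real.exp t - 1) (y k) + 1 =
      if y k ∈ S then Real.exp t else 1 := by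
    by_cases hk : y k ∈ S <;> simp [hk]
  simp only [hfactor]
  rw [Finset.prod_ite, Finset.prod_const, Finset.prod_const_one, mul_one, hitCount, mul_comm,
    Real.exp_nat_mul]

variable [MeasurableSpace X] {μ : Measure X} [IsProbabilityMeasure μ] {S : Set X}

theorem integrable_exp_mul_hitCount (hS : MeasurableSet S) (t : ℝ) :
    Integrable (fun y : ι → X => Real.exp (t * hitCount S y)) (Measure.pi fun _ => μ) := by
  have hfactor : Integrable (fun x => S.indicator (fun _ => Real.exp t - 1) x + 1) μ :=
    ((integrable_const _).indicator hS).add (integrable_const _)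
  simp only [exp_mul_hitCount]
  exact Integrable.fintype_prod fun _ => hfactor

theorem mgf_hitCount_le (hS : MeasurableSet S) (t : ℝ) :
    mgf (fun y : ι → X => (hitCount S y : ℝ)) (Measure.pi fun _ => μ) t ≤
      Real.exp (Fintype.card ι * μ.real S * (Real.exp t - 1)) := by
  have hfactor : ∫ x, (S.indicator (fun _ => Real.exp t - 1) x + 1) ∂μ =
      μ.real S * (Real.exp t - 1) + 1 := by
    rw [integral_add ((integrable_const _).indicator hS) (integrable_const _),
      integral_indicator_const _ hS, integral_const, probReal_univ, smul_eq_mul, one_smul]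
  unfold mgf
  simp only [exp_mul_hitCount]
  rw [integral_fintype_prod_eq_prod (fun _ x => S.indicator (fun _ => Real.exp t - 1) x + 1)]
  simp only [hfactor, Finset.prod_const, Finset.card_univ]
  rw [mul_assoc, Real.exp_nat_mul]
  refine pow_le_pow_left₀ ?_ (Real.add_one_le_exp _) _
  have hle : μ.real S ≤ 1 := measureReal_le_one
  have hnonneg : 0 ≤ μ.real S := measureReal_nonneg
  nlinarith [Real.exp_pos t]

theorem measureReal_le_hitCount_le (hS : MeasurableSet S) (T : ℝ) :
    (Measure.pi fun _ : ι => μ).real {y | T ≤ hitCount S y} ≤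
      Real.exp (2 * (Fintype.card ι * μ.real S) - T) := by
  have hmean : 0 ≤ Fintype.card ι * μ.real S := by positivity
  calc (Measure.pi fun _ : ι => μ).real {y | T ≤ hitCount S y}
      ≤ Real.exp (-1 * T) * mgf (fun y : ι → X => (hitCount S y : ℝ)) (Measure.pi fun _ => μ) 1 :=
        measure_ge_le_exp_mul_mgf T zero_le_one (integrable_exp_mul_hitCount hS 1)
    _ ≤ Real.exp (-1 * T) * Real.exp (Fintype.card ι * μ.real S * (Real.exp 1 - 1)) := by
        gcongr
        exact mgf_hitCount_le hS 1
    _ ≤ Real.exp (2 * (Fintype.card ι * μ.real S) - T) := by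
        rw [← Real.exp_add]
        exact Real.exp_le_exp.2 (by nlinarith [Real.exp_one_lt_d9])

theorem measureReal_hitCount_le_le (hS : MeasurableSet S) (T : ℝ) :
    (Measure.pi fun _ : ι => μ).real {y | (hitCount S y : ℝ) ≤ T} ≤
      Real.exp (T - Fintype.card ι * μ.real S / 2) := by
  have hmean : 0 ≤ Fintype.card ι * μ.real S := by positivity
  have hexp : Real.exp (-1) ≤ 1 / 2 := by
    rw [Real.exp_neg, one_div]
    exact inv_anti₀ two_pos (by linarith [Real.exp_one_gt_d9])
  calc (Measure.pi fun _ : ι => μ).real {y | (hitCount S y : ℝ) ≤ T}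
      ≤ Real.exp (-(-1) * T) *
          mgf (fun y : ι → X => (hitCount S y : ℝ)) (Measure.pi fun _ => μ) (-1) :=
        measure_le_le_exp_mul_mgf T (by norm_num) (integrable_exp_mul_hitCount hS (-1))
    _ ≤ Real.exp (-(-1) * T) * Real.exp (Fintype.card ι * μ.real S * (Real.exp (-1) - 1)) := by
        gcongr
        exact mgf_hitCount_le hS (-1)
    _ ≤ Real.exp (T - Fintype.card ι * μ.real S / 2) := by
        rw [← Real.exp_add]
        exact Real.exp_le_exp.2 (by nlinarith)

end HitCount

/-! ### Great circles that meet a disk -/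

section Disks

open InnerProductGeometry

variable {N : ℕ} {Δ : ℝ} {x : S2} {z : E3}

theorem norm_sub_le_angle {u v : E3} (hu : ‖u‖ = 1) (hv : ‖v‖ = 1) : ‖u - v‖ ≤ angle u v := by
  refine (abs_le_of_sq_le_sq' ?_ (angle_nonneg _ _)).2
  rw [norm_sub_sq_real, hu, hv, ← cos_angle_mul_norm_mul_norm, hu, hv]
  linarith [Real.one_sub_sq_div_two_le_cos (x := angle u v)]

theorem abs_inner_le_of_meets_disk (hz : ‖z‖ = 1)
    (hmeets : (greatCircle x ∩ disk z (diskRadius Δ N)).Nonempty) :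
    |inner ℝ (x : E3) z| ≤ diskAngle Δ N := by
  obtain ⟨u, hcircle, hdisk⟩ := hmeets
  obtain ⟨hu, hangle⟩ := mem_disk_iff.1 hdisk
  calc |inner ℝ (x : E3) z| = |inner ℝ (x : E3) (u - z)| := by
        rw [inner_sub_right, hcircle.2, zero_sub, abs_neg]
    _ ≤ ‖(x : E3)‖ * ‖u - z‖ := abs_real_inner_le_norm _ _
    _ ≤ diskAngle Δ N := by
        rw [norm_coe_S2, one_mul]
        exact (norm_sub_le_angle hu hz).trans hangle

theorem exists_mem_greatCircle_inner_eq (hz : ‖z‖ = 1) (h : inner ℝ (x : E3) z ^ 2 < 1) :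
    ∃ u ∈ greatCircle x, inner ℝ u z = √(1 - inner ℝ (x : E3) z ^ 2) := by
  set s : ℝ := inner ℝ (x : E3) z
  -- The nearest point of the circle is the normalized orthogonal projection of `z`.
  set w : E3 := z - s • (x : E3) with hw
  have hxw : inner ℝ (x : E3) w = (0 : ℝ) := by
    rw [hw, inner_sub_right, real_inner_smul_right, inner_self_S2, mul_one, sub_self]
  have hwz : inner ℝ w z = 1 - s ^ 2 := by
    rw [hw, inner_sub_left, real_inner_smul_left, inner_self_eq_one hz, sq]
  have hww : inner ℝ w w = 1 - s ^ 2 := by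
    rw [← hwz, ← sub_eq_zero, ← inner_sub_right, hw, sub_sub_cancel_left, inner_neg_right,
      real_inner_smul_right, ← hw, real_inner_comm, hxw, mul_zero, neg_zero]
  have hnorm : ‖w‖ = √(1 - s ^ 2) := by
    rw [norm_eq_sqrt_real_inner, hww]
  have hpos : 0 < ‖w‖ := by
    rw [hnorm]
    exact Real.sqrt_pos.2 (by linarith)
  refine ⟨‖w‖⁻¹ • w, ⟨?_, ?_⟩, ?_⟩
  · rw [norm_smul, norm_inv, norm_norm, inv_mul_cancel₀ hpos.ne']
  · rw [real_inner_smul_right, hxw, mul_zero]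
  · rw [real_inner_smul_left, hwz, inv_mul_eq_iff_eq_mul₀ hpos.ne', hnorm,
      Real.mul_self_sqrt (by linarith)]

theorem meets_disk_of_abs_inner_le (hz : ‖z‖ = 1) (hnonneg : 0 ≤ diskAngle Δ N)
    (hlt : diskAngle Δ N < Real.pi / 2)
    (hinner : |inner ℝ (x : E3) z| ≤ 2 / Real.pi * diskAngle Δ N) :
    (greatCircle x ∩ disk z (diskRadius Δ N)).Nonempty := by
  have hcos : 0 < Real.cos (diskAngle Δ N) :=
    Real.cos_pos_of_mem_Ioo ⟨by linarith [Real.pi_pos], hlt⟩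
  have hsq : inner ℝ (x : E3) z ^ 2 ≤ 1 - Real.cos (diskAngle Δ N) ^ 2 := by
    rw [← Real.sin_sq]
    exact sq_le_sq.2 ((hinner.trans (Real.mul_le_sin hnonneg hlt.le)).trans (le_abs_self _))
  obtain ⟨u, hu, huz⟩ := exists_mem_greatCircle_inner_eq (x := x) hz (by nlinarith)
  refine ⟨u, hu, mem_disk_iff.2 ⟨hu.1, ?_⟩⟩
  calc angle u z = Real.arccos (√(1 - inner ℝ (x : E3) z ^ 2)) := by
        rw [angle_eq_arccos_inner hu.1 hz, huz]
    _ ≤ Real.arccos (Real.cos (diskAngle Δ N)) :=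
        Real.arccos_le_arccos (Real.le_sqrt_of_sq_le (by linarith))
    _ = diskAngle Δ N := Real.arccos_cos hnonneg (by linarith)

theorem crossing_swap (x y : S2) : crossing y x = -crossing x y := by
  have hcross : cross y x = -cross x y := by
    rw [cross, cross, ← cross_anticomm, WithLp.toLp_neg]
  rw [crossing, crossing, hcross, norm_neg, smul_neg]

theorem Config.meet_eq_or_eq_neg (s : Config N) (i j : Node N) :
    s.meet i j = crossing (s.pole i) (s.pole j) ∨
      s.meet i j = -crossing (s.pole i) (s.pole j) := by
  unfold meet meetLt
  rw [crossing_swap (s.pole i) (s.pole j)]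
  split_ifs <;> simp

theorem Config.hitCount_band_le_crossingCount (s : Config N) {i j : Node N}
    (hne : crossing (s.pole i) (s.pole j) ≠ 0) (hnonneg : 0 ≤ diskAngle Δ N)
    (hlt : diskAngle Δ N < Real.pi / 2) :
    hitCount (band (crossing (s.pole i) (s.pole j)) (2 / Real.pi * diskAngle Δ N)) s.pole ≤
        s.crossingCount Δ i j ∧
      s.crossingCount Δ i j ≤
        hitCount (band (crossing (s.pole i) (s.pole j)) (diskAngle Δ N)) s.pole := by
  classical
  obtain ⟨hnorm, hband⟩ : ‖s.meet i j‖ = 1 ∧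
      ∀ ε, band (crossing (s.pole i) (s.pole j)) ε = band (s.meet i j) ε := by
    rcases s.meet_eq_or_eq_neg i j with h | h <;> rw [h]
    · exact ⟨norm_crossing hne, fun _ => rfl⟩
    · exact ⟨(norm_neg _).trans (norm_crossing hne), fun ε => (band_neg _ ε).symm⟩
  rw [hband, hband]
  exact ⟨Finset.card_le_card <| Finset.monotone_filter_right _ fun _ _ =>
      meets_disk_of_abs_inner_le hnorm hnonneg hlt,
    Finset.card_le_card <| Finset.monotone_filter_right _ fun _ _ =>
      abs_inner_le_of_meets_disk hnorm⟩

end Disks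

/-! ### Conditioning on the poles of two nodes -/

section Slices

variable {ι X : Type*} [Fintype ι]

theorem pi_le_of_forall_slice_le [MeasurableSpace X] {μ : Measure X} [IsProbabilityMeasure μ]
    (p : ι → Prop) [DecidablePred p] {B : Set (ι → X)} (hB : MeasurableSet B) {δ : ENNReal}
    (hslice : ∀ y : {k // p k} → X, (Measure.pi fun _ : {k // ¬p k} => μ)
      {w | (fun k => if hk : p k then y ⟨k, hk⟩ else w ⟨k, hk⟩) ∈ B} ≤ δ) :
    (Measure.pi fun _ : ι => μ) B ≤ δ := by
  set e := MeasurableEquiv.piEquivPiSubtypeProd (fun _ : ι => X) p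
  have hmp := (measurePreserving_piEquivPiSubtypeProd (fun _ : ι => μ) p).symm e
  calc (Measure.pi fun _ : ι => μ) B
      = ∫⁻ y, (Measure.pi fun _ : {k // ¬p k} => μ) (Prod.mk y ⁻¹' (e.symm ⁻¹' B))
          ∂(Measure.pi fun _ : {k // p k} => μ) := by
        rw [← hmp.measure_preimage hB.nullMeasurableSet, Measure.prod_apply (e.symm.measurable hB)]
    _ ≤ ∫⁻ _, δ ∂(Measure.pi fun _ : {k // p k} => μ) := lintegral_mono hslice
    _ = δ := by rw [lintegral_const, measure_univ, mul_one]

theorem hitCount_le_card (S : Set X) (y : ι → X) : hitCount S y ≤ Fintype.card ι :=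
  Finset.card_le_univ _

theorem hitCount_dite (p : ι → Prop) [DecidablePred p] (S : Set X) (y : {k // p k} → X)
    (w : {k // ¬p k} → X) :
    hitCount S (fun k => if hk : p k then y ⟨k, hk⟩ else w ⟨k, hk⟩) =
      hitCount S y + hitCount S w := by
  classical
  simp only [hitCount, Finset.card_filter]
  rw [← Fintype.sum_subtype_add_sum_subtype p]
  congr 1 <;> refine Finset.sum_congr rfl fun k _ => ?_
  · rw [dif_pos k.2]
  · rw [dif_neg k.2]

end Slices

/-! ### Measurability and null sets -/

section Crossings

theorem continuous_cross : Continuous fun v : E3 × E3 => cross v.1 v.2 := by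
  refine (PiLp.continuous_toLp 2 _).comp (continuous_pi fun i => ?_)
  simp only [crossProduct, LinearMap.mk₂_apply]
  fin_cases i <;>
    simp only [Fin.isValue, Fin.zero_eta, Fin.mk_one, Fin.reduceFinMk, Matrix.cons_val_zero,
      Matrix.cons_val_one, Matrix.cons_val] <;>
    fun_prop

theorem measurable_crossing : Measurable fun x : S2 × S2 => crossing x.1 x.2 := by
  have hcross : Measurable fun x : S2 × S2 => cross x.1 x.2 :=
    (continuous_cross.comp (f := fun x : S2 × S2 => ((x.1 : E3), (x.2 : E3)))
      (by fun_prop)).measurable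
  exact hcross.norm.inv.smul hcross

variable {N : ℕ}

theorem measurable_crossing_poles (i j : Node N) :
    Measurable fun x : Node N → S2 => crossing (x i) (x j) :=
  measurable_crossing.comp (f := fun x : Node N → S2 => (x i, x j)) (by fun_prop)

theorem measurableSet_crossing_eq_zero (i j : Node N) :
    MeasurableSet {x : Node N → S2 | crossing (x i) (x j) = 0} :=
  measurable_crossing_poles i j (measurableSet_singleton 0)

theorem measurable_hitCount_band (i j : Node N) (ε : ℝ) :
    Measurable fun x : Node N → S2 => (hitCount (band (crossing (x i) (x j)) ε) x : ℝ) := by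
  classical
  simp only [hitCount, Finset.card_filter, Nat.cast_sum]
  refine Finset.measurable_sum _ fun k _ =>
    measurable_from_top.comp (Measurable.ite ?_ measurable_const measurable_const)
  have hpole : Measurable fun x : Node N → S2 => (x k : E3) := by fun_prop
  exact measurableSet_le (hpole.inner (𝕜 := ℝ) (measurable_crossing_poles i j)).norm
    measurable_const

theorem sphereUniform_crossing_eq_zero (x : S2) : sphereUniform {y | crossing x y = 0} = 0 := by
  obtain ⟨C₀, C₁, -, -, hup, -⟩ := exists_sphereUniform_band_bounds
  obtain ⟨b, hb⟩ := exists_orthonormalBasis_apply_eq (by simp) (0 : Fin 3) (norm_coe_S2 x)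
  have hxb : inner ℝ (x : E3) (b 1) = (0 : ℝ) := hb ▸ b.orthonormal.2 (by decide)
  -- A pole proportional to `x` lies on each great circle through `x`.
  have hsubset : {y : S2 | crossing x y = 0} ⊆ band (b 1) 0 := by
    intro y hy
    have hcross : cross x y = 0 := by
      rcases smul_eq_zero.1 (show ‖cross x y‖⁻¹ • cross x y = 0 from hy) with h | h
      · exact norm_eq_zero.1 (inv_eq_zero.1 h)
      · exact h
    have hinner := inner_cross_cross x y x (b 1)
    rw [hcross, inner_zero_left, inner_self_S2, hxb, one_mul, zero_mul, sub_zero] at hinner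
    exact (abs_eq_zero.2 hinner.symm).le
  have hband : sphereUniform.real (band (b 1) 0) = 0 :=
    le_antisymm ((hup _ (b.norm_eq_one 1) 0 le_rfl).trans_eq (mul_zero _)) measureReal_nonneg
  exact measure_mono_null hsubset ((measureReal_eq_zero_iff).1 hband)

theorem pi_crossing_eq_zero {i j : Node N} (hij : i ≠ j) :
    (Measure.pi fun _ : Node N => sphereUniform) {x | crossing (x i) (x j) = 0} = 0 := by
  refine le_antisymm (pi_le_of_forall_slice_le (fun k => k = i)
    (measurableSet_crossing_eq_zero i j) fun y => le_of_eq ?_) zero_le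
  have heval := measurePreserving_eval (fun _ : {k : Node N // ¬k = i} => sphereUniform)
    ⟨j, hij.symm⟩
  have hnull := heval.quasiMeasurePreserving.preimage_null
    (sphereUniform_crossing_eq_zero (y ⟨i, rfl⟩))
  convert hnull using 2
  ext w
  simp [hij.symm]

end Crossings

/-! ### The probability of an atypical count -/

section BadPoles

variable {N : ℕ} {Δ a b : ℝ} {i j : Node N}

/-- The poles for which the number of great circles near the intersection of the circles of `i` and
`j` may be out of the range of a typical configuration. Bands replace the disk, so that, given the
poles of `i` and `j`, the number is binomial up to these two nodes. -/
def badPoles (Δ a b : ℝ) (i j : Node N) : Set (Node N → S2) :=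
  {x | crossing (x i) (x j) ≠ 0} ∩
    ({x | b * √((2 * N : ℕ) : ℝ) ≤
        hitCount (band (crossing (x i) (x j)) (diskAngle Δ N)) x} ∪
      {x | (hitCount (band (crossing (x i) (x j)) (2 / Real.pi * diskAngle Δ N)) x : ℝ) ≤
        a * √((2 * N : ℕ) : ℝ)})

theorem measurableSet_badPoles (Δ a b : ℝ) (i j : Node N) :
    MeasurableSet (badPoles Δ a b i j) :=
  (measurableSet_crossing_eq_zero i j).compl.inter
    ((measurableSet_le measurable_const (measurable_hitCount_band i j _)).union
      (measurableSet_le (measurable_hitCount_band i j _) measurable_const))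

theorem Config.typical_of_notMem_badPoles {s : Config N} (hnonneg : 0 ≤ diskAngle Δ N)
    (hlt : diskAngle Δ N < Real.pi / 2)
    (hne : ∀ i j : Node N, i ≠ j → crossing (s.pole i) (s.pole j) ≠ 0)
    (hgood : ∀ i j : Node N, i ≠ j → s.pole ∉ badPoles Δ a b i j) : s.Typical Δ a b := by
  intro i j hij
  obtain ⟨hlower, hupper⟩ := s.hitCount_band_le_crossingCount (hne i j hij) hnonneg hlt
  constructor <;> by_contra! hcount
  · exact hgood i j hij ⟨hne i j hij, Or.inr ((Nat.cast_le.2 hlower).trans hcount.le)⟩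
  · exact hgood i j hij ⟨hne i j hij, Or.inl (hcount.le.trans (Nat.cast_le.2 hupper))⟩

theorem slice_badPoles_subset (y : {k : Node N // k = i ∨ k = j} → S2) {z : E3}
    (hz : crossing (y ⟨i, Or.inl rfl⟩) (y ⟨j, Or.inr rfl⟩) = z) (hij : i ≠ j) :
    {w : {k : Node N // ¬(k = i ∨ k = j)} → S2 |
        (fun k => if hk : k = i ∨ k = j then y ⟨k, hk⟩ else w ⟨k, hk⟩) ∈ badPoles Δ a b i j} ⊆
      {w | b * √((2 * N : ℕ) : ℝ) - 2 ≤ hitCount (band z (diskAngle Δ N)) w} ∪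
        {w | (hitCount (band z (2 / Real.pi * diskAngle Δ N)) w : ℝ) ≤
          a * √((2 * N : ℕ) : ℝ)} := by
  rintro w ⟨-, hw⟩
  simp only [Set.mem_union, Set.mem_ofPred_eq, true_or, or_true, dite_true, hz, hitCount_dite,
    Nat.cast_add] at hw ⊢
  refine hw.imp (fun hupper => ?_) fun hlower => ?_
  · have htwo : (hitCount (band z (diskAngle Δ N)) y : ℝ) ≤ 2 := by
      exact_mod_cast (hitCount_le_card _ y).trans_eq (Fintype.card_subtype_eq_or_eq_of_ne hij)
    linarith
  · exact (le_add_of_nonneg_left (Nat.cast_nonneg _)).trans hlower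

theorem pi_badPoles_le {κ₀ κ₁ : ℝ} (hij : i ≠ j)
    (hup : ∀ z : E3, ‖z‖ = 1 → ((2 * N - 2 : ℕ) : ℝ) *
      sphereUniform.real (band z (diskAngle Δ N)) ≤ κ₁)
    (hlo : ∀ z : E3, ‖z‖ = 1 → κ₀ ≤ ((2 * N - 2 : ℕ) : ℝ) *
      sphereUniform.real (band z (2 / Real.pi * diskAngle Δ N))) :
    (Measure.pi fun _ : Node N => sphereUniform) (badPoles Δ a b i j) ≤
      ENNReal.ofReal (Real.exp (2 * κ₁ - (b * √((2 * N : ℕ) : ℝ) - 2)) +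
        Real.exp (a * √((2 * N : ℕ) : ℝ) - κ₀ / 2)) := by
  refine pi_le_of_forall_slice_le (fun k => k = i ∨ k = j) (measurableSet_badPoles Δ a b i j)
    fun y => ?_
  set z := crossing (y ⟨i, Or.inl rfl⟩) (y ⟨j, Or.inr rfl⟩) with hz
  by_cases hz0 : z = 0
  · refine (measure_mono_null (fun w hw => ?_) measure_empty).trans_le zero_le
    exact hw.1 (by simpa [← hz] using hz0)
  have hz1 : ‖z‖ = 1 := norm_crossing hz0
  have hcard : Fintype.card {k : Node N // ¬(k = i ∨ k = j)} = 2 * N - 2 := by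
    rw [Fintype.card_subtype_compl, Fintype.card_subtype_eq_or_eq_of_ne hij, Fintype.card_fin]
  refine (measure_mono (slice_badPoles_subset y hz.symm hij)).trans
    ((measure_union_le _ _).trans ?_)
  rw [ENNReal.ofReal_add (Real.exp_pos _).le (Real.exp_pos _).le, ← ofReal_measureReal,
    ← ofReal_measureReal]
  refine add_le_add (ENNReal.ofReal_le_ofReal ?_) (ENNReal.ofReal_le_ofReal ?_)
  · refine (measureReal_le_hitCount_le (measurableSet_band z _) _).trans (Real.exp_le_exp.2 ?_)
    rw [hcard]
    linarith [hup z hz1]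
  · refine (measureReal_hitCount_le_le (measurableSet_band z _) _).trans (Real.exp_le_exp.2 ?_)
    rw [hcard]
    linarith [hlo z hz1]

end BadPoles

/-! ### Typical configurations have probability tending to one -/

section Typicality

variable {N : ℕ} {Δ : ℝ}

theorem diskAngle_nonneg (hΔ : 0 ≤ Δ) : 0 ≤ diskAngle Δ N := by
  have := Real.pi_pos
  unfold diskAngle
  positivity

theorem diskAngle_lt_pi_div_two [NeZero (latticeSize N)] (hΔ : 0 ≤ Δ)
    (hlarge : 4 * (2 + Δ) < latticeSize N) : diskAngle Δ N < Real.pi / 2 := by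
  have hpos : (0 : ℝ) < latticeSize N := by linarith
  refine (diskAngle_le hΔ).trans_lt ?_
  rw [div_lt_div_iff₀ hpos two_pos]
  nlinarith [Real.pi_pos]

theorem exists_mean_hitCount_bounds (hΔ : 0 ≤ Δ) :
    ∃ κ₀ κ₁ : ℝ, 0 < κ₀ ∧ ∀ N : ℕ, 2 ≤ N → 4 * (2 + Δ) < latticeSize N → ∀ z : E3, ‖z‖ = 1 →
      ((2 * N - 2 : ℕ) : ℝ) * sphereUniform.real (band z (diskAngle Δ N)) ≤
        κ₁ * √((2 * N : ℕ) : ℝ) ∧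
      κ₀ * √((2 * N : ℕ) : ℝ) ≤
        ((2 * N - 2 : ℕ) : ℝ) * sphereUniform.real (band z (2 / Real.pi * diskAngle Δ N)) := by
  obtain ⟨C₀, C₁, hC₀, hC₁, hup, hlo⟩ := exists_sphereUniform_band_bounds
  refine ⟨2 * C₀ * (2 + Δ), 2 * Real.pi * (2 + Δ) * C₁, by positivity,
    fun N hN hlarge z hz => ?_⟩
  set r := √((2 * N : ℕ) : ℝ) with hr
  have hrpos : 0 < r := by linarith [latticeSize_le_sqrt (N := N)]
  have hsq : r * r = 2 * N := by
    rw [hr, Real.mul_self_sqrt (Nat.cast_nonneg _), Nat.cast_mul, Nat.cast_two]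
  have hcast : ((2 * N - 2 : ℕ) : ℝ) = r * r - 2 := by
    rw [Nat.cast_sub (by omega), Nat.cast_mul, Nat.cast_two, hsq]
  have htwo : (2 : ℝ) ≤ N := by exact_mod_cast hN
  have hangle : 2 / Real.pi * diskAngle Δ N = 4 * (2 + Δ) / r := by
    rw [diskAngle, ← hr]
    field_simp
    ring
  constructor
  · calc ((2 * N - 2 : ℕ) : ℝ) * sphereUniform.real (band z (diskAngle Δ N))
        ≤ (r * r) * (C₁ * diskAngle Δ N) :=
          mul_le_mul (by linarith) (hup z hz _ (diskAngle_nonneg hΔ)) measureReal_nonneg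
            (by positivity)
      _ = 2 * Real.pi * (2 + Δ) * C₁ * r := by
          rw [diskAngle, ← hr]
          field_simp
  · have hle_one : 4 * (2 + Δ) / r ≤ 1 :=
      (div_le_one hrpos).2 (by linarith [latticeSize_le_sqrt (N := N)])
    calc 2 * C₀ * (2 + Δ) * r = r * r / 2 * (C₀ * (4 * (2 + Δ) / r)) := by
          field_simp
          ring
      _ ≤ ((2 * N - 2 : ℕ) : ℝ) *
            sphereUniform.real (band z (2 / Real.pi * diskAngle Δ N)) := by
          rw [hangle]
          exact mul_le_mul (by linarith) (hlo z hz _ (by positivity) hle_one) (by positivity)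
            (by positivity)

/-- The bound that Chernoff's inequality gives for the probability that the number of great circles
near one intersection point is atypical. -/
def tailBound (κ : ℝ) (N : ℕ) : ℝ :=
  Real.exp (2 - √((2 * N : ℕ) : ℝ)) + Real.exp (-(κ * √((2 * N : ℕ) : ℝ)))

theorem exists_pi_badPoles_le (hΔ : 0 ≤ Δ) :
    ∃ a₀ b₀ κ : ℝ, 0 < a₀ ∧ a₀ < b₀ ∧ 0 < κ ∧ ∀ a b : ℝ, a ≤ a₀ → b₀ ≤ b →
      ∀ N : ℕ, 2 ≤ N → 4 * (2 + Δ) < latticeSize N → ∀ i j : Node N, i ≠ j →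
        (Measure.pi fun _ : Node N => sphereUniform) (badPoles Δ a b i j) ≤
          ENNReal.ofReal (tailBound κ N) := by
  obtain ⟨κ₀, κ₁, hκ₀, hmean⟩ := exists_mean_hitCount_bounds hΔ
  refine ⟨κ₀ / 4, max (2 * κ₁ + 1) (κ₀ / 4 + 1), κ₀ / 4, by positivity,
    lt_max_of_lt_right (by linarith), by positivity, fun a b ha hb N hN hlarge i j hij => ?_⟩
  refine (pi_badPoles_le hij (fun z hz => (hmean N hN hlarge z hz).1)
    fun z hz => (hmean N hN hlarge z hz).2).trans (ENNReal.ofReal_le_ofReal ?_)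
  have hr := Real.sqrt_nonneg ((2 * N : ℕ) : ℝ)
  refine add_le_add (Real.exp_le_exp.2 ?_) (Real.exp_le_exp.2 ?_)
  · nlinarith [(le_max_left _ _).trans hb]
  · nlinarith

theorem tendsto_sq_mul_tailBound {κ : ℝ} (hκ : 0 < κ) :
    Tendsto (fun N : ℕ => ((2 * N : ℕ) : ℝ) ^ 2 * tailBound κ N) atTop (𝓝 0) := by
  have hsqrt : Tendsto (fun N : ℕ => √((2 * N : ℕ) : ℝ)) atTop atTop :=
    Real.tendsto_sqrt_atTop.comp
      (tendsto_natCast_atTop_atTop.comp (tendsto_id.const_mul_atTop' two_pos))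
  have hexp (l : ℝ) (hl : 0 < l) : Tendsto
      (fun N : ℕ => √((2 * N : ℕ) : ℝ) ^ 4 * Real.exp (-(l * √((2 * N : ℕ) : ℝ)))) atTop
      (𝓝 0) := by
    have h := ((Real.tendsto_pow_mul_exp_neg_atTop_nhds_zero 4).comp
      (hsqrt.const_mul_atTop hl)).const_mul ((l ^ 4)⁻¹)
    rw [mul_zero] at h
    refine h.congr fun N => ?_
    simp only [Function.comp_apply, mul_pow]
    field_simp
  have h := ((hexp 1 one_pos).const_mul (Real.exp 2)).add (hexp κ hκ)
  rw [mul_zero, add_zero] at h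
  refine h.congr fun N => ?_
  have hpow : √((2 * N : ℕ) : ℝ) ^ 4 = ((2 * N : ℕ) : ℝ) ^ 2 := by
    rw [show 4 = 2 * 2 from rfl, pow_mul, Real.sq_sqrt (Nat.cast_nonneg _)]
  rw [hpow, tailBound, sub_eq_add_neg, Real.exp_add, one_mul]
  ring

instance : Nonempty (Pairing N) :=
  ⟨Fintype.equivOfCardEq (by simp [mul_comm])⟩

instance : IsProbabilityMeasure (configMeasure N) := by
  unfold configMeasure
  infer_instance

instance [NeZero (latticeSize N)] (p α : unitInterval) :
    IsProbabilityMeasure (law p α N) := by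
  unfold law
  infer_instance

theorem law_pole_mem [NeZero (latticeSize N)] (p α : unitInterval) (B : Set (Node N → S2)) :
    law p α N {ω | ω.1.pole ∈ B} = (Measure.pi fun _ : Node N => sphereUniform) B := by
  have hset : {ω : Sample N | ω.1.pole ∈ B} = (B ×ˢ Set.univ) ×ˢ Set.univ :=
    Set.ext fun ω => ⟨fun h => ⟨⟨h, trivial⟩, trivial⟩, fun h => h.1.1⟩
  rw [hset, law, Measure.prod_prod, configMeasure, Measure.prod_prod, measure_univ, measure_univ,
    mul_one, mul_one]

theorem law_not_typical_le {a b δ : ℝ} (hΔ : 0 ≤ Δ) [NeZero (latticeSize N)]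
    (hlarge : 4 * (2 + Δ) < latticeSize N) (p α : unitInterval)
    (hbad : ∀ i j : Node N, i ≠ j → (Measure.pi fun _ : Node N => sphereUniform)
      (badPoles Δ a b i j) ≤ ENNReal.ofReal δ) :
    law p α N {ω | ¬ω.1.Typical Δ a b} ≤ ENNReal.ofReal (((2 * N : ℕ) : ℝ) ^ 2 * δ) := by
  set B : Node N → Node N → Set (Node N → S2) := fun i j =>
    {x | i ≠ j ∧ (crossing (x i) (x j) = 0 ∨ x ∈ badPoles Δ a b i j)} with hB
  have hB_le (i j : Node N) :
      (Measure.pi fun _ : Node N => sphereUniform) (B i j) ≤ ENNReal.ofReal δ := by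
    by_cases hij : i = j
    · simp [hB, hij]
    · refine (measure_mono fun x hx => hx.2).trans ((measure_union_le
        {x : Node N → S2 | crossing (x i) (x j) = 0} (badPoles Δ a b i j)).trans ?_)
      rw [pi_crossing_eq_zero hij, zero_add]
      exact hbad i j hij
  have hsubset : {ω : Sample N | ¬ω.1.Typical Δ a b} ⊆ {ω | ω.1.pole ∈ ⋃ i, ⋃ j, B i j} := by
    intro ω hω
    by_contra hnot
    simp only [hB, Set.mem_ofPred_eq, Set.mem_iUnion, not_exists, not_and, not_or] at hnot
    exact hω (Config.typical_of_notMem_badPoles (diskAngle_nonneg hΔ)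
      (diskAngle_lt_pi_div_two hΔ hlarge) (fun i j hij => (hnot i j hij).1)
      fun i j hij => (hnot i j hij).2)
  calc law p α N {ω | ¬ω.1.Typical Δ a b}
      ≤ (Measure.pi fun _ : Node N => sphereUniform) (⋃ i, ⋃ j, B i j) :=
        (measure_mono hsubset).trans_eq (law_pole_mem p α _)
    _ ≤ ∑ i, ∑ j, (Measure.pi fun _ : Node N => sphereUniform) (B i j) :=
        (measure_iUnion_fintype_le _ _).trans
          (Finset.sum_le_sum fun i _ => measure_iUnion_fintype_le _ _)
    _ ≤ ∑ _i : Node N, ∑ _j : Node N, ENNReal.ofReal δ :=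
        Finset.sum_le_sum fun i _ => Finset.sum_le_sum fun j _ => hB_le i j
    _ = ENNReal.ofReal (((2 * N : ℕ) : ℝ) ^ 2 * δ) := by
        rw [ENNReal.ofReal_mul (by positivity), ENNReal.ofReal_pow (by positivity),
          ENNReal.ofReal_natCast]
        simp only [Finset.sum_const, Finset.card_univ, Fintype.card_fin, nsmul_eq_mul]
        ring

theorem tendsto_latticeSize : Tendsto (fun N => (latticeSize N : ℝ)) atTop atTop := by
  refine tendsto_natCast_atTop_atTop.comp (tendsto_atTop.2 fun k => ?_)
  filter_upwards [eventually_ge_atTop (k * k)] with N hN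
  exact Nat.le_sqrt.2 (by omega)

theorem exists_tendsto_law_not_typical (hΔ : 0 ≤ Δ) :
    ∃ a₀ b₀ : ℝ, 0 < a₀ ∧ a₀ < b₀ ∧ ∀ a b : ℝ, a ≤ a₀ → b₀ ≤ b → ∀ p α : unitInterval,
      Tendsto (fun N => law p α N {ω | ¬ω.1.Typical Δ a b}) atTop (𝓝 0) := by
  obtain ⟨a₀, b₀, κ, ha₀, hab₀, hκ, hbad⟩ := exists_pi_badPoles_le hΔ
  refine ⟨a₀, b₀, ha₀, hab₀, fun a b ha hb p α => ?_⟩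
  have hlimit := ENNReal.tendsto_ofReal (tendsto_sq_mul_tailBound hκ)
  rw [ENNReal.ofReal_zero] at hlimit
  refine tendsto_of_tendsto_of_tendsto_of_le_of_le' tendsto_const_nhds hlimit
    (Eventually.of_forall fun _ => zero_le) ?_
  filter_upwards [eventually_ge_atTop 2,
    tendsto_latticeSize.eventually_gt_atTop (4 * (2 + Δ))] with N hN hlarge
  have : NeZero (latticeSize N) := ⟨(latticeSize_pos (by omega)).ne'⟩
  exact law_not_typical_le hΔ hlarge p α (hbad a b ha hb N hN hlarge)

end Typicality

/-! ### The throughput of the scheme -/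

theorem hasThroughput_bitsPi {Δ a b W : ℝ} {p α : unitInterval} (hΔ : 0 ≤ Δ) (ha : 0 < a)
    (hb : 0 ≤ b) (hW : 0 ≤ W) (hp : 0 < p) (hp1 : p < 1) (hα : 0 < α)
    (htypical : Tendsto (fun N => law p α N {ω | ¬ω.1.Typical Δ a b}) atTop (𝓝 0))
    (P : ∀ N, Placement N) :
    HasThroughput (law p α) (fun N => bitsPi Δ W a b (P N))
      fun _ => W * rateConst Δ b p α / 8 := by
  have hlower : Tendsto (fun N => 1 - law p α N {ω | ¬ω.1.Typical Δ a b}) atTop (𝓝 1) := by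
    simpa using ENNReal.Tendsto.sub (tendsto_const_nhds (x := 1)) htypical
      (Or.inl ENNReal.one_ne_top)
  refine tendsto_of_tendsto_of_tendsto_of_le_of_le' hlower tendsto_const_nhds ?_ ?_
  · filter_upwards [eventually_ge_atTop 2,
      tendsto_latticeSize.eventually_ge_atTop ((2 * nearBound Δ : ℕ) : ℝ)] with N hN hlarge
    have : NeZero (latticeSize N) := ⟨(latticeSize_pos (by omega)).ne'⟩
    refine tsub_le_iff_right.2 ?_
    have hcover : ∀ᵐ ω ∂law p α N, ω ∈ {ω | ∀ c : Fin N, W * rateConst Δ b p α / 8 ≤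
        liminf (fun t : ℕ => bitsPi Δ W a b (P N) ω c t / (t : ℝ)) atTop} ∪
        {ω | ¬ω.1.Typical Δ a b} := by
      filter_upwards [ae_regularFrequencies p α] with ω hreg
      refine or_iff_not_imp_right.2 fun hω c => ?_
      exact le_liminf_bitsPi_of_typical hΔ ha hb (Nat.cast_le.1 hlarge) hp hp1 hα
        (not_not.1 hω) hreg hW hN c
    calc 1 = law p α N Set.univ := measure_univ.symm
      _ ≤ _ := measure_mono_ae (hcover.mono fun _ h _ => h)
      _ ≤ _ := measure_union_le _ _
  · filter_upwards [eventually_ge_atTop 1] with N hN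
    have : NeZero (latticeSize N) := ⟨(latticeSize_pos (by omega)).ne'⟩
    exact prob_le_one

end

end MobileNet

theorem mainTheorem2_general (Δ : ℝ) (hΔ : 0 ≤ Δ) :
    ∃ a₀ b₀ : ℝ, 0 < a₀ ∧ a₀ < b₀ ∧ ∀ a b : ℝ, 0 < a → a ≤ a₀ → b₀ ≤ b →
      ∀ (W : ℝ) (p α : unitInterval), 0 < W → 0 < p → p < 1 → 0 < α →
        ∃ c C : ℝ, 0 < c ∧ ∀ P : ∀ N, MobileNet.Placement N,
          MobileNet.HasThroughput (MobileNet.law p α)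
            (fun N => MobileNet.bitsPi Δ W a b (P N)) (fun _ => c) ∧
          ∀ T : ℕ → ℝ,
            MobileNet.HasThroughput (MobileNet.law p α)
              (fun N => MobileNet.bitsPi Δ W a b (P N)) T →
            ∀ᶠ N in Filter.atTop, T N ≤ C := by
  obtain ⟨a₀, b₀, ha₀, hab₀, htypical⟩ := MobileNet.exists_tendsto_law_not_typical hΔ
  refine ⟨a₀, b₀, ha₀, hab₀, fun a b ha haa₀ hb₀b W p α hW hp hp1 hα => ?_⟩
  have hrate := MobileNet.rateConst_pos Δ b hp hp1 hα
  refine ⟨W * MobileNet.rateConst Δ b p α / 8, W, by positivity, fun P => ⟨?_, fun T hT => ?_⟩⟩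
  · exact MobileNet.hasThroughput_bitsPi hΔ ha (by linarith) hW.le hp hp1 hα
      (htypical a b haa₀ hb₀b p α) P
  · exact MobileNet.eventually_le_of_hasThroughput Δ hW.le a b p α P hT

theorem mainTheorem2 (Δ : ℝ) (hΔ : 0 < Δ) :
    ∃ a₀ b₀ : ℝ, 0 < a₀ ∧ a₀ < b₀ ∧ ∀ a b : ℝ, 0 < a → a ≤ a₀ → b₀ ≤ b →
      ∀ (W : ℝ) (p α : unitInterval), 0 < W → 0 < p → p < 1 → 0 < α → α < 1 →
        ∃ c C : ℝ, 0 < c ∧ ∀ P : ∀ N, MobileNet.Placement N,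
          MobileNet.HasThroughput (MobileNet.law p α)
            (fun N => MobileNet.bitsPi Δ W a b (P N)) (fun _ => c) ∧
          ∀ T : ℕ → ℝ,
            MobileNet.HasThroughput (MobileNet.law p α)
              (fun N => MobileNet.bitsPi Δ W a b (P N)) T →
            ∀ᶠ N in Filter.atTop, T N ≤ C := by
  obtain ⟨a₀, b₀, ha₀, hab₀, h⟩ := mainTheorem2_general Δ hΔ.le
  exact ⟨a₀, b₀, ha₀, hab₀, fun a b ha haa₀ hb₀b W p α hW hp hp1 hα _ =>
    h a b ha haa₀ hb₀b W p α hW hp hp1 hα⟩
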